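/- Work over $\mathbb{C}$. Let $W$ be a vector space of dimension $k+1$ and let $\iota=(\ell_0,\dots,\ell_n)\colon W\hookrightarrow\mathbb{C}^{n+1}$ be an injective linear map with coordinates $\ell_i\in W^*$. Let $L\subset\mathbb{P}^n$ be the image of $\mathbb{P}W$, a linear space of dimension $k$, let $$L^{\circ 2}=\{[x_0^2:\dots:x_n^2] \mid [x_0:\dots:x_n]\in L\}\subset\mathbb{P}^n$$ be its coordinate-wise square, and let $Z=\{[\ell_i] \mid \ell_i\neq 0\}\subset\mathbb{P}W^*$ be the associated point configuration. Assume that $Z$ lies on a unique quadric, that is, the space of quadratic forms on $W^*$ vanishing on $Z$ is spanned by a single non-zero form $q$, and let $s$ be the rank of $q$. Then $s\geq 2$, and there are $n-\binom{k+2}{2}+2$ linear forms in $\mathbb{C}[x_0,\dots,x_n]$ together with $$\begin{cases} \frac{(k+3)(k+2)(k+1)(k-2)}{12}\text{ quadratic forms}, & \text{if } s\geq 4,\\[2pt] \frac{(k+3)(k+2)(k+1)(k-2)}{12}\text{ quadratic forms and } 7 \text{ cubic forms}, & \text{if } s=3,\\[2pt] \frac{(k+3)(k+2)(k+1)(k-2)}{12}+2\text{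 quadratic forms}, & \text{if } s=2, \end{cases}$$ the forms of each degree being linearly independent over $\mathbb{C}$, whose common zero set in $\mathbb{P}^n$ is $L^{\circ 2}$. If $s\geq 3$, the forms moreover cut out $L^{\circ 2}$ scheme-theoretically: the ideal they generate and the vanishing ideal of $L^{\circ 2}$ define the same closed subscheme of $\mathbb{P}^n$, i.e. they become equal on every standard affine chart $\{x_i\neq 0\}$. -/

import Mathlib

open scoped LinearAlgebra.Projectivization

noncomputable section

/-- Complex projective `n`-space, with homogeneous coordinates `x₀, …, xₙ`. -/
abbrev PSpace (n : ℕ) : Type := ℙ ℂ (Fin (n + 1) → ℂ)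

/-- The homogeneous coordinate ring `ℂ[x₀, …, xₙ]` of projective `n`-space. -/
abbrev CoordRing (n : ℕ) : Type := MvPolynomial (Fin (n + 1)) ℂ

theorem sq_coords_ne_zero {n : ℕ} {v : Fin (n + 1) → ℂ} (hv : v ≠ 0) :
    (fun i => v i ^ 2) ≠ 0 := by
  intro h
  exact hv (funext fun i => by simpa using congrFun h i)

/-- The coordinate-wise squaring map `[x₀ : … : xₙ] ↦ [x₀² : … : xₙ²]`. -/
def coordSq {n : ℕ} (p : PSpace n) : PSpace n :=
  Projectivization.mk ℂ (fun i => p.rep i ^ 2) (sq_coords_ne_zero p.rep_nonzero)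

/-- The squaring map does not depend on the chosen representative. -/
theorem coordSq_mk {n : ℕ} (v : Fin (n + 1) → ℂ) (hv : v ≠ 0) :
    coordSq (Projectivization.mk ℂ v hv) =
      Projectivization.mk ℂ (fun i => v i ^ 2) (sq_coords_ne_zero hv) := by
  obtain ⟨a, ha⟩ := Projectivization.exists_smul_eq_mk_rep ℂ v hv
  unfold coordSq
  rw [Projectivization.mk_eq_mk_iff]
  refine ⟨a ^ 2, ?_⟩
  funext i
  rw [← ha]
  simp [Units.smul_def, mul_pow]

section Configuration

variable {n : ℕ} {W : Type*} [AddCommGroup W] [Module ℂ W]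

/-- The linear space `L ⊆ ℙⁿ` that is the image of the embedding `ℙ W → ℙⁿ` induced by an
injective linear map `ι : W → ℂⁿ⁺¹`. -/
def linearSpace (ι : W →ₗ[ℂ] (Fin (n + 1) → ℂ)) (hι : Function.Injective ι) : Set (PSpace n) :=
  Set.range (Projectivization.map ι hι)

/-- The `i`-th coordinate `ℓᵢ ∈ W*` of `ι`. -/
def coordForm (ι : W →ₗ[ℂ] (Fin (n + 1) → ℂ)) (i : Fin (n + 1)) : Module.Dual ℂ W :=
  LinearMap.proj i ∘ₗ ι

/-- The point configuration `Z = {[ℓᵢ] | ℓᵢ ≠ 0} ⊆ ℙ W*`. -/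
def pointConfig (ι : W →ₗ[ℂ] (Fin (n + 1) → ℂ)) : Set (ℙ ℂ (Module.Dual ℂ W)) :=
  {p | ∃ (i : Fin (n + 1)) (h : coordForm ι i ≠ 0), p = Projectivization.mk ℂ (coordForm ι i) h}

end Configuration

section Quadrics

variable {V : Type*} [AddCommGroup V] [Module ℂ V]

/-- The space `I(Z)₂` of all quadratic forms on `V` that vanish on the subset `Z` of `ℙ V`. -/
def quadricsThrough (Z : Set (ℙ ℂ V)) : Submodule ℂ (QuadraticForm ℂ V) where
  carrier := {Q | ∀ p ∈ Z, ∀ v ∈ p.submodule, Q v = 0}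
  zero_mem' := by intro p _ v _; simp
  add_mem' := by
    intro Q R hQ hR p hp v hv
    simp [hQ p hp v hv, hR p hp v hv]
  smul_mem' := by
    intro c Q hQ p hp v hv
    simp [hQ p hp v hv]

/-- The rank of a quadratic form: the rank of its associated symmetric bilinear form. -/
def quadRank (Q : QuadraticForm ℂ V) : ℕ :=
  Module.finrank ℂ (LinearMap.range (QuadraticMap.associated Q))

end Quadrics

section Subschemes

variable {n : ℕ}

/-- The set of points of `ℙⁿ` at which all elements of an ideal vanish. -/
def projZeros (J : Ideal (CoordRing n)) : Set (PSpace n) :=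
  {p | ∀ f ∈ J, ∀ v ∈ p.submodule, MvPolynomial.eval v f = 0}

/-- The affine cone over a subset of `ℙⁿ`. -/
def affineCone (X : Set (PSpace n)) : Set (Fin (n + 1) → ℂ) :=
  {v | ∃ p ∈ X, v ∈ p.submodule}

/-- The (homogeneous) ideal of all polynomials vanishing on a subset of `ℙⁿ`. -/
def definingIdeal (X : Set (PSpace n)) : Ideal (CoordRing n) :=
  MvPolynomial.vanishingIdeal ℂ (affineCone X)

/-- Restriction to the standard chart `{xᵢ ≠ 0} ≅ 𝔸ⁿ` of `ℙⁿ`: substitute `xᵢ = 1`. -/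
def chart (i : Fin (n + 1)) : CoordRing n →ₐ[ℂ] MvPolynomial {j : Fin (n + 1) // j ≠ i} ℂ :=
  MvPolynomial.aeval fun j => if h : j ≠ i then MvPolynomial.X ⟨j, h⟩ else 1

/-- Two homogeneous ideals define the same closed subscheme of `ℙⁿ`: their restrictions to every
standard affine chart coincide. -/
def SameSubscheme (I J : Ideal (CoordRing n)) : Prop :=
  ∀ i : Fin (n + 1), I.map (chart i) = J.map (chart i)

/-- A system of `m` forms of degree `d`, linearly independent over `ℂ`. -/
structure IsFormSystem (d : ℕ) {m : ℕ} (f : Fin m → CoordRing n) : Prop where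
  isHomogeneous : ∀ i, (f i).IsHomogeneous d
  linearIndependent : LinearIndependent ℂ f

end Subschemes

end

/-!
In coordinates `w` on `W`, the square of `L` is the image of `w ↦ (ℓᵢ(w)²)ᵢ`, that is, the image of
the Veronese variety under the linear projection `Sym² W → ℂⁿ⁺¹` given by the `ℓᵢ²`. The kernel of
this projection consists of the quadrics through `Z`, so the centre is the single point `q`, and the
span `U` of the `ℓᵢ²` consists of all quadratic polynomials apolar to `q` (`span_squareForm`).
If `q` had rank one, the `ℓᵢ` would have a common zero, so `s ≥ 2`.

The forms are relations among the elements of `U`: the linear relations among the `ℓᵢ²`, the kernel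
of `Sym² U → U²`, and for `s = 3` the kernel of `Sym³ U' → U'³` for the five-dimensional space `U'`
of ternary polynomials in `U`. Their numbers follow from the dimensions of `U²` and `U'³`: these are
all quartics, respectively all ternary sextics, if `s ≥ 3` (`apolar_diag_sq`, `apolar_diag_cube`),
whereas for `s = 2` the space `U²` misses two monomials (`finrank_apolar_hyp_sq`).

A point `ξ` of a `ℂ`-algebra `B` at which the relations vanish is the same as a linear map
`Y : U → B` such that products `Y p * Y q` (and triple products on `U'`) depend only on `p * q`
(`exists_relations`). To see that the relations suffice, one reconstructs a preimage of the point
locally. If `e` is a linear form isotropic for `q` and `c = Y (e²)` is invertible, then the preimage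
`u`, normalized by `e(u) = 1`, has to satisfy `c v(u) = Y (e v)` for all `v` orthogonal to `e`. This
determines `u` if `e` lies in the radical (`exists_eval_of_radical_chart`). Otherwise one coordinate
is missing; it is found from `Y (ee' - 2f²)` for an isotropic partner `e'` of `e` and a third vector
`f` of an orthogonal basis, and the equations for `Y (e'v)` and `Y (e'²)` follow from quadratic
relations if there is a fourth vector, and from the cubic ones if `s = 3`
(`exists_eval_of_isUnit_isoForm`). These charts cover everything (`map_mem_of_charts_mem`). With
`B = ℂ` this gives the equality of sets, and with `B` a localization of the quotient by the ideal of
the relations it gives the equality of schemes. If `s = 2`, the missing coordinate is not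
determined, but over `ℂ` the few points outside the radical charts are found by hand
(`exists_eval_of_hyp`).
-/

open MvPolynomial

/-! ### Homogeneous polynomials and relations among products -/

/-- A linear map that vanishes on the kernel of `f` factors through `f`, with the factor defined on
the whole target of `f`. -/
theorem LinearMap.exists_comp_eq_of_ker_le {K E F G : Type*} [Field K] [AddCommGroup E]
    [AddCommGroup F] [AddCommGroup G] [Module K E] [Module K F] [Module K G]
    (f : E →ₗ[K] F) (g : E →ₗ[K] G) (h : LinearMap.ker f ≤ LinearMap.ker g) :
    ∃ k : F →ₗ[K] G, ∀ x, k (f x) = g x := by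
  obtain ⟨r, hr⟩ := f.rangeRestrict.exists_rightInverse_of_surjective f.range_rangeRestrict
  obtain ⟨k, hk⟩ := LinearMap.exists_extend (g ∘ₗ r)
  refine ⟨k, fun x => ?_⟩
  have h1 := LinearMap.congr_fun hk (f.rangeRestrict x)
  have h2 := congrArg Subtype.val (LinearMap.congr_fun hr (f.rangeRestrict x))
  have h3 : r (f.rangeRestrict x) - x ∈ LinearMap.ker g := h (by simpa [sub_eq_zero] using h2)
  have h4 : g (r (f.rangeRestrict x)) = g x := by simpa [sub_eq_zero] using h3
  exact h1.trans h4

theorem Submodule.finrank_map_add_finrank_inf_ker {K E F : Type*} [Field K] [AddCommGroup E]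
    [AddCommGroup F] [Module K E] [Module K F] (f : E →ₗ[K] F) (H : Submodule K E)
    [FiniteDimensional K H] :
    Module.finrank K (H.map f) + Module.finrank K (H ⊓ LinearMap.ker f : Submodule K E) =
      Module.finrank K H := by
  rw [← (f ∘ₗ H.subtype).finrank_range_add_finrank_ker, LinearMap.range_comp, H.range_subtype,
    LinearMap.ker_comp, ← Submodule.map_comap_subtype,
    ← (Submodule.equivMapOfInjective _ H.subtype_injective _).finrank_eq]

instance finiteDimensional_homogeneousSubmodule {σ : Type*} [Finite σ] (d : ℕ) :
    FiniteDimensional ℂ (homogeneousSubmodule σ ℂ d) :=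
  Module.Finite.iff_fg.mpr (homogeneousSubmodule_fg σ ℂ d)

theorem finrank_homogeneousSubmodule (r d : ℕ) :
    Module.finrank ℂ (homogeneousSubmodule (Fin r) ℂ d) = (r + d - 1).choose d := by
  classical
  rw [homogeneousSubmodule_eq_finsupp_supported]
  have e : Sym (Fin r) d ≃ {P : Fin r →₀ ℕ | P.degree = d} :=
    (Sym.equivNatSum (Fin r) d).trans (Equiv.subtypeEquivRight fun P => by
      simp [Finsupp.degree_apply, Finsupp.sum])
  have : Finite {P : Fin r →₀ ℕ | P.degree = d} := Finite.of_equiv _ e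
  have := Fintype.ofFinite {P : Fin r →₀ ℕ | P.degree = d}
  rw [(AddMonoidAlgebra.supportedEquivFinsupp (R := ℂ) (S := ℂ)
    {P : Fin r →₀ ℕ | P.degree = d}).finrank_eq, Module.finrank_finsupp_self,
    ← Fintype.card_congr e, Sym.card_sym_eq_choose, Fintype.card_fin]

section Relations

variable {n : ℕ} {R : Type*} [CommRing R] [Algebra ℂ R]

/-- The linear relations among `x₀, …, xₙ`, as linear forms. They cut out the points `ξ` that
extend to a linear map `xᵢ ↦ ξᵢ`. -/
theorem exists_linear_relations (x : Fin (n + 1) → R) :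
    ∃ (a : ℕ) (f : Fin a → CoordRing n), IsFormSystem 1 f ∧
      a + Module.finrank ℂ (Submodule.span ℂ (Set.range x)) = n + 1 ∧
      (∀ j, aeval x (f j) = 0) ∧
      ∀ (B : Type) [CommRing B] [Algebra ℂ B] (ξ : Fin (n + 1) → B),
        (∀ j, aeval ξ (f j) = 0) → ∃ Y : R →ₗ[ℂ] B, ∀ i, Y (x i) = ξ i := by
  let φ : (Fin (n + 1) → ℂ) →ₗ[ℂ] R := Fintype.linearCombination ℂ x
  let T : (Fin (n + 1) → ℂ) →ₗ[ℂ] CoordRing n := Fintype.linearCombination ℂ X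
  have hT : Function.Injective T :=
    (linearIndependent_X (Fin (n + 1)) ℂ).fintypeLinearCombination_injective
  have haev : ∀ {B : Type _} [CommRing B] [Algebra ℂ B] (ξ : Fin (n + 1) → B) c,
      aeval ξ (T c) = Fintype.linearCombination ℂ ξ c := by
    intro B _ _ ξ c
    simp [T, Fintype.linearCombination_apply]
  have haev' : ∀ c, aeval x (T c) = φ c := by
    intro c
    simp [T, φ, Fintype.linearCombination_apply]
  let β := Module.finBasis ℂ (LinearMap.ker φ)
  refine ⟨_, fun j => T (β j), ⟨fun j => ?_, ?_⟩, ?_, fun j => ?_, ?_⟩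
  · simp only [T, Fintype.linearCombination_apply]
    exact IsHomogeneous.sum _ _ _ fun i _ =>
      (homogeneousSubmodule (Fin (n + 1)) ℂ 1).smul_mem _ (isHomogeneous_X _ _)
  · exact (β.linearIndependent.map' _ (LinearMap.ker φ).ker_subtype).map' T
      (LinearMap.ker_eq_bot.mpr hT)
  · have := φ.finrank_range_add_finrank_ker
    rw [Fintype.range_linearCombination, Module.finrank_fin_fun] at this
    omega
  · rw [haev']; exact (β j).2
  · intro B _ _ ξ h
    obtain ⟨Y, hY⟩ := LinearMap.exists_comp_eq_of_ker_le φ (Fintype.linearCombination ℂ ξ) (by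
      intro c hc
      have h1 : (Fintype.linearCombination ℂ ξ ∘ₗ (LinearMap.ker φ).subtype) = 0 :=
        β.ext fun j => (haev ξ _).symm.trans (h j)
      exact LinearMap.congr_fun h1 ⟨c, hc⟩)
    refine ⟨Y, fun i => ?_⟩
    have := hY (Pi.single i 1)
    classical
    simpa [φ, Fintype.linearCombination_apply_single] using this

/-- The relations of degree `d` among the elements of a space `U` spanned by linear combinations
of `x₀, …, xₙ`, as forms in `x₀, …, xₙ`. Their number is the dimension of the kernel of the
multiplication `Symᵈ U → Uᵈ`, and they cut out the points at which `d`-fold products of elements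
of `U` can be evaluated consistently. -/
theorem exists_relations (x : Fin (n + 1) → R) (U : Submodule ℂ R)
    (hU : U ≤ Submodule.span ℂ (Set.range x)) (d : ℕ) :
    ∃ (b : ℕ) (f : Fin b → CoordRing n), IsFormSystem d f ∧
      b + Module.finrank ℂ (U ^ d : Submodule ℂ R) = (Module.finrank ℂ U + d - 1).choose d ∧
      (∀ j, aeval x (f j) = 0) ∧
      ∀ (B : Type) [CommRing B] [Algebra ℂ B] (ξ : Fin (n + 1) → B) (Y : R →ₗ[ℂ] B),
        (∀ i, Y (x i) = ξ i) → (∀ j, aeval ξ (f j) = 0) →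
          ∃ Z : R →ₗ[ℂ] B, ∀ a : Fin d → R, (∀ i, a i ∈ U) → Z (∏ i, a i) = ∏ i, Y (a i) := by
  classical
  have : FiniteDimensional ℂ U :=
    have := FiniteDimensional.span_of_finite ℂ (Set.finite_range x)
    Submodule.finiteDimensional_of_le hU
  set r := Module.finrank ℂ U with hr
  let β : Module.Basis (Fin r) ℂ U := Module.finBasis ℂ U
  have hlift : ∀ j, ∃ c : Fin (n + 1) → ℂ, ∑ i, c i • x i = (β j : R) := fun j =>
    (Submodule.mem_span_range_iff_exists_fun ℂ).mp (hU (β j).2)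
  choose c hc using hlift
  have hcind : LinearIndependent ℂ c := by
    have h1 : LinearIndependent ℂ (fun j => (β j : R)) :=
      β.linearIndependent.map' _ U.ker_subtype
    have h2 : (fun j => (β j : R)) = Fintype.linearCombination ℂ x ∘ c := by
      funext j; simp [Fintype.linearCombination_apply, hc]
    rw [h2] at h1
    exact LinearIndependent.of_comp _ h1
  let θ : MvPolynomial (Fin r) ℂ →ₐ[ℂ] CoordRing n := aeval fun j => ∑ i, c j i • X i
  let φ : MvPolynomial (Fin r) ℂ →ₐ[ℂ] R := aeval fun j => (β j : R)
  have hθφ : ∀ p, aeval x (θ p) = φ p := by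
    intro p
    have : (aeval x).comp θ = φ := by
      ext j; simp [θ, φ, hc]
    exact DFunLike.congr_fun this p
  have hθinj : Function.Injective θ := by
    -- a linear left inverse of `c` gives a left inverse of the substitution `θ`
    obtain ⟨D, hD⟩ := LinearMap.exists_leftInverse_of_injective (Fintype.linearCombination ℂ c)
      (LinearMap.ker_eq_bot.mpr hcind.fintypeLinearCombination_injective)
    let T : (Fin r → ℂ) →ₗ[ℂ] MvPolynomial (Fin r) ℂ := Fintype.linearCombination ℂ X
    let κ : CoordRing n →ₐ[ℂ] MvPolynomial (Fin r) ℂ := aeval fun i => T (D (Pi.single i 1))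
    have : κ.comp θ = AlgHom.id ℂ _ := by
      ext1 j
      have h1 : D (c j) = Pi.single j 1 := by
        have := LinearMap.congr_fun hD (Pi.single j 1)
        simpa [Fintype.linearCombination_apply_single] using this
      have h2 : ∑ i, c j i • T (D (Pi.single i 1)) = T (D (c j)) := by
        simp only [← map_smul, ← map_sum]
        congr 2
        funext i
        simp [Finset.sum_apply, Pi.single_apply]
      simp only [AlgHom.comp_apply, θ, aeval_X, map_sum, map_smul, κ, h2, h1, AlgHom.id_apply]
      simp only [T, Fintype.linearCombination_apply_single, one_smul]
    exact Function.LeftInverse.injective (g := κ) fun p => DFunLike.congr_fun this p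
  let H := homogeneousSubmodule (Fin r) ℂ d
  have hmap : H.map φ.toLinearMap = U ^ d := by
    have h1 : (homogeneousSubmodule (Fin r) ℂ 1).map φ.toLinearMap = U := by
      rw [homogeneousSubmodule_one_eq_span_X, Submodule.map_span, ← Set.range_comp]
      have : (φ.toLinearMap ∘ X) = U.subtype ∘ β := by
        funext j; exact (aeval_X _ j).trans rfl
      rw [this, Set.range_comp, ← Submodule.map_span, β.span_eq, Submodule.map_top,
        Submodule.range_subtype]
    simp only [H]
    rw [← homogeneousSubmodule_one_pow, Submodule.map_pow, h1]
  have : FiniteDimensional ℂ (H ⊓ LinearMap.ker φ.toLinearMap : Submodule ℂ _) :=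
    Submodule.finiteDimensional_of_le (inf_le_left (a := H))
  let γ := Module.finBasis ℂ (H ⊓ LinearMap.ker φ.toLinearMap : Submodule ℂ _)
  refine ⟨_, fun j => θ (γ j), ⟨fun j => ?_, ?_⟩, ?_, fun j => ?_, ?_⟩
  · have := IsHomogeneous.aeval (n := 1) (γ j).2.1 (fun j => ∑ i, c j i • X i : Fin r → CoordRing n)
      fun j => IsHomogeneous.sum _ _ _ fun i _ =>
        (homogeneousSubmodule (Fin (n + 1)) ℂ 1).smul_mem _ (isHomogeneous_X _ _)
    rw [one_mul] at this
    exact this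
  · exact (γ.linearIndependent.map' _ (Submodule.ker_subtype _)).map'
      θ.toLinearMap (LinearMap.ker_eq_bot.mpr hθinj)
  · have := Submodule.finrank_map_add_finrank_inf_ker φ.toLinearMap H
    rw [hmap, finrank_homogeneousSubmodule] at this
    omega
  · rw [hθφ]; exact (γ j).2.2
  · intro B _ _ ξ Y hY h
    have hΨ : ∀ p, aeval ξ (θ p) = aeval (fun j => Y (β j)) p := by
      intro p
      have : (aeval ξ).comp θ = aeval (fun j => Y (β j)) := by
        ext j; simp [θ, ← hc, hY]
      exact DFunLike.congr_fun this p
    obtain ⟨Z, hZ⟩ := LinearMap.exists_comp_eq_of_ker_le (φ.toLinearMap ∘ₗ H.subtype)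
      ((aeval fun j => Y (β j)).toLinearMap ∘ₗ H.subtype) (by
        intro p hp
        have h1 : ((aeval fun j => Y (β j)).toLinearMap ∘ₗ
            (H ⊓ LinearMap.ker φ.toLinearMap : Submodule ℂ _).subtype) = 0 :=
          γ.ext fun j => (hΨ _).symm.trans (h j)
        exact LinearMap.congr_fun h1 ⟨p, p.2, hp⟩)
    refine ⟨Z, fun a ha => ?_⟩
    let T : (Fin r → ℂ) →ₗ[ℂ] MvPolynomial (Fin r) ℂ := Fintype.linearCombination ℂ X
    let α : Fin d → MvPolynomial (Fin r) ℂ := fun i => T (β.repr ⟨a i, ha i⟩)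
    have hsum : ∀ i, ∑ j, β.repr ⟨a i, ha i⟩ j • (β j : R) = a i := fun i => by
      have := congrArg U.subtype (β.sum_repr ⟨a i, ha i⟩)
      simp only [map_sum, map_smul] at this
      exact this
    have hφα : ∀ i, φ (α i) = a i := fun i => by
      simp [α, T, φ, Fintype.linearCombination_apply, hsum]
    have hYα : ∀ i, aeval (fun j => Y (β j)) (α i) = Y (a i) := fun i => by
      rw [← hsum i]; simp [α, T, Fintype.linearCombination_apply]
    have hα : (∏ i, α i) ∈ H := by
      have := IsHomogeneous.prod Finset.univ α (fun _ => 1) fun i _ =>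
        IsHomogeneous.sum _ _ _ fun j _ =>
          (homogeneousSubmodule (Fin r) ℂ 1).smul_mem _ (isHomogeneous_X _ _)
      simpa [H] using this
    have := hZ ⟨_, hα⟩
    simpa [hφα, hYα] using this

end Relations

/-! ### Quadratic polynomials apolar to a quadric -/

section Apolar

variable {m : ℕ}

/-- To contain all forms of degree `d`, it suffices to contain the products of `d` variables. -/
theorem homogeneousSubmodule_le_of_prod_X_mem {d : ℕ} (S : Submodule ℂ (MvPolynomial (Fin m) ℂ))
    (h : ∀ a : Fin d → Fin m, (∏ i, X (a i)) ∈ S) : homogeneousSubmodule (Fin m) ℂ d ≤ S := by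
  rw [← homogeneousSubmodule_one_pow, homogeneousSubmodule_one_eq_span_X, Submodule.span_pow,
    Submodule.span_le]
  intro p hp
  obtain ⟨f, rfl⟩ := Set.mem_pow.mp hp
  choose a ha using fun i => (f i).2
  rw [List.prod_ofFn]
  simp only [← ha]
  exact h a

/-- The contraction of a quadratic polynomial with the symmetric matrix `G`; it sends `XₐX_b` to
`G a b`. -/
noncomputable def contraction (G : Fin m → Fin m → ℂ) : MvPolynomial (Fin m) ℂ →ₗ[ℂ] ℂ :=
  ∑ a, ∑ b, (G a b / 2) • ((aeval (0 : Fin m → ℂ)).toLinearMap ∘ₗ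
    (pderiv a).toLinearMap ∘ₗ (pderiv b).toLinearMap)

theorem contraction_X_mul_X {G : Fin m → Fin m → ℂ} (hG : ∀ a b, G a b = G b a) (a b : Fin m) :
    contraction G (X a * X b) = G a b := by
  have h : ∀ i j, (aeval (0 : Fin m → ℂ)) (pderiv i (pderiv j (X a * X b : MvPolynomial (Fin m)
    ℂ))) =
      (if i = b then if j = a then (1 : ℂ) else 0 else 0) +
        if i = a then if j = b then (1 : ℂ) else 0 else 0 := by
    intro i j
    have hX : ∀ j a : Fin m, pderiv j (X a : MvPolynomial (Fin m) ℂ) =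
        C (if j = a then 1 else 0) := by
      intro j a
      rw [pderiv_X, Pi.single_apply]
      split_ifs <;> simp_all
    simp only [pderiv_mul, hX, map_add, pderiv_C, map_mul, aeval_C, zero_mul, mul_zero,
      zero_add, add_zero]
    simp only [Algebra.algebraMap_self, RingHom.id_apply, mul_ite, mul_one, mul_zero]
    congr 1
    split_ifs <;> rfl
  simp only [contraction, LinearMap.sum_apply, LinearMap.smul_apply, LinearMap.comp_apply,
    AlgHom.toLinearMap_apply, Derivation.coeFn_coe, h, smul_eq_mul,
    mul_add, mul_ite, mul_one, mul_zero, Finset.sum_add_distrib, Finset.sum_ite_eq',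
    Finset.sum_ite_irrel, Finset.sum_const_zero, Finset.mem_univ, if_true, hG b a]
  ring

/-- The quadratic polynomials apolar to the quadric with Gram matrix `G`. -/
noncomputable def apolar (G : Fin m → Fin m → ℂ) : Submodule ℂ (MvPolynomial (Fin m) ℂ) :=
  homogeneousSubmodule (Fin m) ℂ 2 ⊓ LinearMap.ker (contraction G)

theorem X_mul_X_mem_homogeneousSubmodule (a b : Fin m) :
    (X a * X b : MvPolynomial (Fin m) ℂ) ∈ homogeneousSubmodule (Fin m) ℂ 2 :=
  (isHomogeneous_X ℂ a).mul (isHomogeneous_X ℂ b)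

theorem X_mul_X_mem_apolar {G : Fin m → Fin m → ℂ} (hG : ∀ a b, G a b = G b a) {a b : Fin m}
    (h : G a b = 0) : X a * X b ∈ apolar G :=
  ⟨X_mul_X_mem_homogeneousSubmodule a b, by simp [contraction_X_mul_X hG, h]⟩

theorem X_mul_X_sub_mem_apolar {G : Fin m → Fin m → ℂ} (hG : ∀ a b, G a b = G b a)
    {a b c d : Fin m} (h : G a b = G c d) : X a * X b - X c * X d ∈ apolar G :=
  ⟨sub_mem (X_mul_X_mem_homogeneousSubmodule a b) (X_mul_X_mem_homogeneousSubmodule c d), by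
    simp [contraction_X_mul_X hG, h]⟩

/-- If `G i j ≠ 0`, the polynomials apolar to `G` are spanned by the differences of `XₐX_b` and the
multiple of `XᵢXⱼ` with the same contraction. (For `G i j = 0` the assumption says that `S`
contains all `XₐX_b`.) -/
theorem apolar_le {G : Fin m → Fin m → ℂ} (hG : ∀ a b, G a b = G b a) (i j : Fin m)
    (S : Submodule ℂ (MvPolynomial (Fin m) ℂ))
    (h : ∀ a b, X a * X b - (G a b / G i j) • (X i * X j) ∈ S) : apolar G ≤ S := by
  let N : MvPolynomial (Fin m) ℂ →ₗ[ℂ] MvPolynomial (Fin m) ℂ :=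
    LinearMap.id - (contraction G).smulRight ((1 / G i j) • (X i * X j))
  have h1 : homogeneousSubmodule (Fin m) ℂ 2 ≤ S.comap N := by
    refine homogeneousSubmodule_le_of_prod_X_mem _ fun a => ?_
    have := h (a 0) (a 1)
    simp only [Fin.prod_univ_two, Submodule.mem_comap, N, LinearMap.sub_apply, LinearMap.id_apply,
      LinearMap.smulRight_apply, contraction_X_mul_X hG, smul_smul, mul_one_div]
    exact this
  intro p hp
  have h2 : contraction G p = 0 := hp.2
  have h3 : N p ∈ S := h1 hp.1
  simpa [N, h2] using h3

theorem finrank_apolar {G : Fin m → Fin m → ℂ} (hG : ∀ a b, G a b = G b a) {i j : Fin m}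
    (hij : G i j ≠ 0) : Module.finrank ℂ (apolar G) + 1 = (m + 1).choose 2 := by
  have h := Submodule.finrank_map_add_finrank_inf_ker (contraction G)
    (homogeneousSubmodule (Fin m) ℂ 2)
  have htop : (homogeneousSubmodule (Fin m) ℂ 2).map (contraction G) = ⊤ := by
    refine eq_top_iff.mpr fun c _ => ⟨(c / G i j) • (X i * X j), ?_, ?_⟩
    · exact Submodule.smul_mem _ _ (X_mul_X_mem_homogeneousSubmodule i j)
    · simp [contraction_X_mul_X hG, hij]
  rw [htop, finrank_homogeneousSubmodule, finrank_top, Module.finrank_self] at h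
  rw [apolar, add_comm, h]
  rfl

/-- The Gram matrix of the diagonal quadric `∑_{a ∈ P} eₐ²`. -/
def diagGram (P : Finset (Fin m)) (a b : Fin m) : ℂ := if a = b ∧ a ∈ P then 1 else 0

theorem diagGram_comm (P : Finset (Fin m)) (a b : Fin m) : diagGram P a b = diagGram P b a := by
  unfold diagGram; congr 1; grind

theorem diagGram_of_ne (P : Finset (Fin m)) {a b : Fin m} (h : a ≠ b) : diagGram P a b = 0 := by
  simp [diagGram, h]

theorem diagGram_self_of_mem {P : Finset (Fin m)} {a : Fin m} (h : a ∈ P) :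
    diagGram P a a = 1 := by
  simp [diagGram, h]

theorem diagGram_self_of_notMem {P : Finset (Fin m)} {a : Fin m} (h : a ∉ P) :
    diagGram P a a = 0 := by
  simp [diagGram, h]

theorem X_mul_X_mem_apolar_diag (P : Finset (Fin m)) {a b : Fin m} (h : a ≠ b) :
    X a * X b ∈ apolar (diagGram P) :=
  X_mul_X_mem_apolar (diagGram_comm P) (diagGram_of_ne P h)

theorem X_sq_mem_apolar_diag {P : Finset (Fin m)} {r : Fin m} (h : r ∉ P) :
    X r * X r ∈ apolar (diagGram P) :=
  X_mul_X_mem_apolar (diagGram_comm P) (diagGram_self_of_notMem h)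

theorem X_sq_sub_mem_apolar_diag {P : Finset (Fin m)} {a b : Fin m} (ha : a ∈ P) (hb : b ∈ P) :
    X a * X a - X b * X b ∈ apolar (diagGram P) :=
  X_mul_X_sub_mem_apolar (diagGram_comm P) (by
    rw [diagGram_self_of_mem ha, diagGram_self_of_mem hb])

theorem apolar_diag_le {P : Finset (Fin m)} {k : Fin m} (hk : k ∈ P)
    (S : Submodule ℂ (MvPolynomial (Fin m) ℂ)) (h1 : ∀ a b, a ≠ b → X a * X b ∈ S)
    (h2 : ∀ r, r ∉ P → X r * X r ∈ S) (h3 : ∀ a ∈ P, X a * X a - X k * X k ∈ S) :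
    apolar (diagGram P) ≤ S := by
  refine apolar_le (diagGram_comm P) k k S ?_
  intro a b
  by_cases hab : a = b
  · subst hab
    by_cases ha : a ∈ P
    · simpa [diagGram_self_of_mem, ha, hk] using h3 a ha
    · simpa [diagGram_self_of_notMem, ha] using h2 a ha
  · simpa [diagGram_of_ne P hab] using h1 a b hab

/-- If the diagonal quadric has rank at least three, products of two polynomials apolar to it span
all quartics. -/
theorem apolar_diag_sq {P : Finset (Fin m)} (hP : 3 ≤ P.card) :
    apolar (diagGram P) ^ 2 = homogeneousSubmodule (Fin m) ℂ 4 := by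
  set U := apolar (diagGram P) with hU
  refine le_antisymm ?_ (homogeneousSubmodule_le_of_prod_X_mem _ fun a => ?_)
  · rw [pow_two]
    exact (mul_le_mul' inf_le_left inf_le_left).trans (homogeneousSubmodule_mul 2 2)
  rw [pow_two]
  have mul : ∀ {p q : MvPolynomial (Fin m) ℂ}, p ∈ U → q ∈ U → p * q ∈ U * U :=
    fun hp hq => Submodule.mul_mem_mul hp hq
  have avoid : ∀ a b : Fin m, ∃ j ∈ P, j ≠ a ∧ j ≠ b := by
    intro a b
    obtain ⟨j, hj, hj'⟩ := Finset.exists_mem_notMem_of_card_lt_card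
      (s := {a, b}) (t := P) ((Finset.card_le_two).trans_lt hP)
    exact ⟨j, hj, by simpa using hj'⟩
  have cube : ∀ a d : Fin m, X a * X a * X a * X d ∈ U * U := by
    intro a d
    by_cases ha : a ∈ P
    · obtain ⟨j, hj, hja, hjd⟩ := avoid a d
      by_cases had : a = d
      · subst had
        obtain ⟨k, hk, hka, hkj⟩ := avoid a j
        have : (X a * X a * X a * X a : MvPolynomial (Fin m) ℂ) =
            (X a * X a - X j * X j) * (X a * X a - X k * X k) + (X a * X k) * (X a * X k) +
              (X a * X j) * (X a * X j) - (X j * X k) * (X j * X k) := by ring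
        rw [this]
        have h1 := X_mul_X_mem_apolar_diag P hka.symm
        have h2 := X_mul_X_mem_apolar_diag P hja.symm
        have h3 := X_mul_X_mem_apolar_diag P hkj.symm
        exact sub_mem (add_mem (add_mem (mul (X_sq_sub_mem_apolar_diag ha hj)
          (X_sq_sub_mem_apolar_diag ha hk)) (mul h1 h1)) (mul h2 h2)) (mul h3 h3)
      · have : (X a * X a * X a * X d : MvPolynomial (Fin m) ℂ) =
            (X a * X a - X j * X j) * (X a * X d) + (X a * X j) * (X j * X d) := by ring
        rw [this]
        exact add_mem (mul (X_sq_sub_mem_apolar_diag ha hj) (X_mul_X_mem_apolar_diag P had))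
          (mul (X_mul_X_mem_apolar_diag P hja.symm) (X_mul_X_mem_apolar_diag P hjd))
    · have h1 := X_sq_mem_apolar_diag ha
      rw [mul_assoc]
      by_cases had : a = d
      · subst had; exact mul h1 h1
      · exact mul h1 (X_mul_X_mem_apolar_diag P had)
  have pairs : ∀ {a b c d : Fin m}, a ≠ b → c ≠ d → (X a * X b) * (X c * X d) ∈ U * U :=
    fun h1 h2 => mul (X_mul_X_mem_apolar_diag P h1) (X_mul_X_mem_apolar_diag P h2)
  rw [Fin.prod_univ_four]
  generalize a 0 = a, a 1 = b, a 2 = c, a 3 = d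
  by_cases h1 : a ≠ b ∧ c ≠ d
  · convert pairs h1.1 h1.2 using 1; ring
  by_cases h2 : a ≠ c ∧ b ≠ d
  · convert pairs h2.1 h2.2 using 1; ring
  by_cases h3 : a ≠ d ∧ b ≠ c
  · convert pairs h3.1 h3.2 using 1; ring
  have h : (a = b ∧ a = c) ∨ (a = b ∧ a = d) ∨ (a = c ∧ a = d) ∨ (b = c ∧ b = d) := by grind
  rcases h with ⟨rfl, rfl⟩ | ⟨rfl, rfl⟩ | ⟨rfl, rfl⟩ | ⟨rfl, rfl⟩
  · exact cube a d
  · convert cube a c using 1; ring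
  · convert cube a b using 1; ring
  · convert cube b a using 1; ring

/-- If the diagonal quadric has rank at least three, products of three polynomials apolar to it
span all sextics. -/
theorem apolar_diag_cube {P : Finset (Fin m)} (hP : 3 ≤ P.card) :
    apolar (diagGram P) ^ 3 = homogeneousSubmodule (Fin m) ℂ 6 := by
  rw [pow_succ', apolar_diag_sq hP]
  refine le_antisymm ?_ (homogeneousSubmodule_le_of_prod_X_mem _ fun a => ?_)
  · exact (mul_le_mul' inf_le_left le_rfl).trans (homogeneousSubmodule_mul 2 4)
  have quart : ∀ a b c d : Fin m, (X a * X b * X c * X d : MvPolynomial (Fin m) ℂ) ∈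
      homogeneousSubmodule (Fin m) ℂ 4 := fun a b c d =>
    (((isHomogeneous_X ℂ a).mul (isHomogeneous_X ℂ b)).mul (isHomogeneous_X ℂ c)).mul
      (isHomogeneous_X ℂ d)
  have ne : ∀ {a b : Fin m} (c d e f : Fin m), a ≠ b →
      (X a * X b) * (X c * X d * X e * X f) ∈
        apolar (diagGram P) * homogeneousSubmodule (Fin m) ℂ 4 := fun c d e f h =>
    Submodule.mul_mem_mul (X_mul_X_mem_apolar_diag P h) (quart c d e f)
  rw [Fin.prod_univ_six]
  generalize a 0 = a, a 1 = b, a 2 = c, a 3 = d, a 4 = e, a 5 = f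
  by_cases h1 : a ≠ b
  · convert ne c d e f h1 using 1; ring
  by_cases h2 : a ≠ c
  · convert ne b d e f h2 using 1; ring
  by_cases h3 : a ≠ d
  · convert ne b c e f h3 using 1; ring
  by_cases h4 : a ≠ e
  · convert ne b c d f h4 using 1; ring
  by_cases h5 : a ≠ f
  · convert ne b c d e h5 using 1; ring
  push Not at h1 h2 h3 h4 h5
  subst h1 h2 h3 h4 h5
  by_cases ha : a ∈ P
  · obtain ⟨j, hj, hja⟩ : ∃ j ∈ P, j ≠ a := by
      obtain ⟨j, hj, hj'⟩ := Finset.exists_mem_notMem_of_card_lt_card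
        (s := {a}) (t := P) (by simp; omega)
      exact ⟨j, hj, by simpa using hj'⟩
    have : (X a * X a * X a * X a * X a * X a : MvPolynomial (Fin m) ℂ) =
        (X a * X a - X j * X j) * (X a * X a * X a * X a) +
          (X a * X j) * (X a * X a * X a * X j) := by ring
    rw [this]
    exact add_mem (Submodule.mul_mem_mul (X_sq_sub_mem_apolar_diag ha hj) (quart a a a a))
      (ne a a a j hja.symm)
  · convert Submodule.mul_mem_mul (X_sq_mem_apolar_diag ha) (quart a a a a) using 1; ring

end Apolar

/-! ### Apolarity to a quadric of rank two -/

section Hyperbolic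

variable {m : ℕ}

/-- The Gram matrix of the hyperbolic quadric `2eᵢeⱼ` of rank two. -/
def hypGram (i j a b : Fin m) : ℂ := if (a = i ∧ b = j) ∨ (a = j ∧ b = i) then 1 else 0

theorem hypGram_comm (i j a b : Fin m) : hypGram i j a b = hypGram i j b a := by
  unfold hypGram; congr 1; grind

theorem hypGram_self (i j : Fin m) : hypGram i j i j = 1 := by simp [hypGram]

theorem hypGram_eq_zero {i j a b : Fin m} (h : ¬((a = i ∧ b = j) ∨ (a = j ∧ b = i))) :
    hypGram i j a b = 0 := by simp [hypGram, h]

theorem apolar_hyp_le (i j : Fin m) (S : Submodule ℂ (MvPolynomial (Fin m) ℂ))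
    (h : ∀ a b, ¬((a = i ∧ b = j) ∨ (a = j ∧ b = i)) → X a * X b ∈ S) :
    apolar (hypGram i j) ≤ S := by
  refine apolar_le (hypGram_comm i j) i j S fun a b => ?_
  by_cases hab : (a = i ∧ b = j) ∨ (a = j ∧ b = i)
  · have h1 : (X a * X b : MvPolynomial (Fin m) ℂ) = X i * X j := by
      rcases hab with ⟨rfl, rfl⟩ | ⟨rfl, rfl⟩
      · rfl
      · exact mul_comm _ _
    simp [hypGram, hab, h1]
  · simpa [hypGram_eq_zero hab] using h a b hab

theorem coeff_prod_four_X (a b c d : Fin m) (e : Fin m →₀ ℕ) :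
    coeff e (X a * X b * (X c * X d) : MvPolynomial (Fin m) ℂ) =
      if Finsupp.single a 1 + Finsupp.single b 1 + (Finsupp.single c 1 + Finsupp.single d 1) = e
        then 1 else 0 := by
  simp only [X, monomial_mul, coeff_monomial, mul_one]

/-- A product of two products of two variables, each different from `XᵢXⱼ`, is different from
`Xᵢ³Xⱼ`. -/
theorem coeff_prod_four_X_eq_zero {i j a b c d : Fin m} (hij : i ≠ j)
    (h1 : ¬((a = i ∧ b = j) ∨ (a = j ∧ b = i))) (h2 : ¬((c = i ∧ d = j) ∨ (c = j ∧ d = i))) :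
    coeff (Finsupp.single i 3 + Finsupp.single j 1)
      (X a * X b * (X c * X d) : MvPolynomial (Fin m) ℂ) = 0 := by
  rw [coeff_prod_four_X, if_neg]
  intro h
  have hi := DFunLike.congr_fun h i
  have hj := DFunLike.congr_fun h j
  simp only [Finsupp.add_apply, Finsupp.single_apply] at hi hj
  grind

/-- Products of two polynomials apolar to the rank two quadric `2eᵢeⱼ` span all quartics without
the monomials `Xᵢ³Xⱼ` and `XᵢXⱼ³`. -/
theorem finrank_apolar_hyp_sq {i j : Fin m} (hij : i ≠ j) :
    Module.finrank ℂ (apolar (hypGram i j) ^ 2 : Submodule ℂ (MvPolynomial (Fin m) ℂ)) + 2 =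
      (m + 3).choose 4 := by
  set U := apolar (hypGram i j) with hU
  let f : MvPolynomial (Fin m) ℂ →ₗ[ℂ] ℂ × ℂ :=
    (lcoeff ℂ (Finsupp.single i 3 + Finsupp.single j 1)).prod
      (lcoeff ℂ (Finsupp.single j 3 + Finsupp.single i 1))
  let p : MvPolynomial (Fin m) ℂ := X i * X i * (X i * X j)
  let q : MvPolynomial (Fin m) ℂ := X j * X j * (X j * X i)
  have hfp : f p = (1, 0) := by
    have h1 : ¬(Finsupp.single i 1 + Finsupp.single i 1 + (Finsupp.single i 1 + Finsupp.single j 1)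
        = (Finsupp.single j 3 + Finsupp.single i 1 : Fin m →₀ ℕ)) := by
      intro h
      have := DFunLike.congr_fun h j
      simp [hij] at this
    have h2 : Finsupp.single i 1 + Finsupp.single i 1 + (Finsupp.single i 1 + Finsupp.single j 1)
        = (Finsupp.single i 3 + Finsupp.single j 1 : Fin m →₀ ℕ) := by
      rw [← add_assoc, ← Finsupp.single_add, ← Finsupp.single_add]
    change (coeff _ p, coeff _ p) = _
    rw [coeff_prod_four_X, coeff_prod_four_X, if_pos h2, if_neg h1]
  have hfq : f q = (0, 1) := by
    have h1 : ¬(Finsupp.single j 1 + Finsupp.single j 1 + (Finsupp.single j 1 + Finsupp.single i 1)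
        = (Finsupp.single i 3 + Finsupp.single j 1 : Fin m →₀ ℕ)) := by
      intro h
      have := DFunLike.congr_fun h i
      simp [hij.symm] at this
    have h2 : Finsupp.single j 1 + Finsupp.single j 1 + (Finsupp.single j 1 + Finsupp.single i 1)
        = (Finsupp.single j 3 + Finsupp.single i 1 : Fin m →₀ ℕ) := by
      rw [← add_assoc, ← Finsupp.single_add, ← Finsupp.single_add]
    change (coeff _ q, coeff _ q) = _
    rw [coeff_prod_four_X, coeff_prod_four_X, if_neg h1, if_pos h2]
  have hp : p ∈ homogeneousSubmodule (Fin m) ℂ 4 :=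
    (X_mul_X_mem_homogeneousSubmodule i i).mul (X_mul_X_mem_homogeneousSubmodule i j)
  have hq : q ∈ homogeneousSubmodule (Fin m) ℂ 4 :=
    (X_mul_X_mem_homogeneousSubmodule j j).mul (X_mul_X_mem_homogeneousSubmodule j i)
  have hker : U ^ 2 ≤ LinearMap.ker f := by
    have h1 : U ≤ Submodule.span ℂ {p | ∃ a b, ¬((a = i ∧ b = j) ∨ (a = j ∧ b = i)) ∧
        p = X a * X b} :=
      apolar_hyp_le i j _ fun a b hab => Submodule.subset_span ⟨a, b, hab, rfl⟩
    rw [pow_two]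
    refine (mul_le_mul' h1 h1).trans ?_
    rw [Submodule.span_mul_span, Submodule.span_le]
    rintro _ ⟨_, ⟨a, b, hab, rfl⟩, _, ⟨c, d, hcd, rfl⟩, rfl⟩
    have h2 := coeff_prod_four_X_eq_zero hij hab hcd
    have h3 := coeff_prod_four_X_eq_zero hij.symm (fun h => hab h.symm) (fun h => hcd h.symm)
    simp [f, h2, h3]
  have hsq : homogeneousSubmodule (Fin m) ℂ 4 ⊓ LinearMap.ker f = U ^ 2 := by
    refine le_antisymm ?_ (le_inf ?_ hker)
    · let N : MvPolynomial (Fin m) ℂ →ₗ[ℂ] MvPolynomial (Fin m) ℂ :=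
        LinearMap.id - (LinearMap.fst ℂ ℂ ℂ ∘ₗ f).smulRight p -
          (LinearMap.snd ℂ ℂ ℂ ∘ₗ f).smulRight q
      have hN : homogeneousSubmodule (Fin m) ℂ 4 ≤ (U ^ 2).comap N := by
        refine homogeneousSubmodule_le_of_prod_X_mem _ fun a => ?_
        rw [Fin.prod_univ_four]
        generalize a 0 = a, a 1 = b, a 2 = c, a 3 = d
        have hmem : X a * X b * X c * X d ∈ U ^ 2 ∨ X a * X b * X c * X d = p ∨
            X a * X b * X c * X d = q := by
          have pairs : ∀ {a b c d : Fin m}, ¬((a = i ∧ b = j) ∨ (a = j ∧ b = i)) →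
              ¬((c = i ∧ d = j) ∨ (c = j ∧ d = i)) → X a * X b * (X c * X d) ∈ U ^ 2 := by
            intro a b c d h1 h2
            rw [pow_two]
            exact Submodule.mul_mem_mul
              (X_mul_X_mem_apolar (hypGram_comm i j) (hypGram_eq_zero h1))
              (X_mul_X_mem_apolar (hypGram_comm i j) (hypGram_eq_zero h2))
          by_cases h1 : ¬((a = i ∧ b = j) ∨ (a = j ∧ b = i)) ∧
              ¬((c = i ∧ d = j) ∨ (c = j ∧ d = i))
          · left; convert pairs h1.1 h1.2 using 1; ring
          by_cases h2 : ¬((a = i ∧ c = j) ∨ (a = j ∧ c = i)) ∧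
              ¬((b = i ∧ d = j) ∨ (b = j ∧ d = i))
          · left; convert pairs h2.1 h2.2 using 1; ring
          by_cases h3 : ¬((a = i ∧ d = j) ∨ (a = j ∧ d = i)) ∧
              ¬((b = i ∧ c = j) ∨ (b = j ∧ c = i))
          · left; convert pairs h3.1 h3.2 using 1; ring
          right
          have h : (a = j ∧ b = i ∧ c = i ∧ d = i) ∨ (a = i ∧ b = j ∧ c = i ∧ d = i) ∨
              (a = i ∧ b = i ∧ c = j ∧ d = i) ∨ (a = i ∧ b = i ∧ c = i ∧ d = j) ∨
              (a = i ∧ b = j ∧ c = j ∧ d = j) ∨ (a = j ∧ b = i ∧ c = j ∧ d = j) ∨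
              (a = j ∧ b = j ∧ c = i ∧ d = j) ∨ (a = j ∧ b = j ∧ c = j ∧ d = i) := by
            clear pairs hker hp hq hfp hfq
            have ha : a = i ∨ a = j := by grind
            have hb : b = i ∨ b = j := by grind
            rcases ha with rfl | rfl <;> rcases hb with rfl | rfl <;> grind
          rcases h with ⟨rfl, rfl, rfl, rfl⟩ | ⟨rfl, rfl, rfl, rfl⟩ | ⟨rfl, rfl, rfl, rfl⟩ |
            ⟨rfl, rfl, rfl, rfl⟩ | ⟨rfl, rfl, rfl, rfl⟩ | ⟨rfl, rfl, rfl, rfl⟩ |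
            ⟨rfl, rfl, rfl, rfl⟩ | ⟨rfl, rfl, rfl, rfl⟩
          iterate 4 exact Or.inl (by simp only [p]; ring)
          iterate 4 exact Or.inr (by simp only [q]; ring)
        rcases hmem with h | h | h
        · have h0 : f (X a * X b * X c * X d) = 0 := hker h
          simpa [N, h0] using h
        · rw [h]; simp [N, hfp]
        · rw [h]; simp [N, hfq]
      intro r hr
      have h0 : f r = 0 := hr.2
      have h1 : N r ∈ U ^ 2 := hN hr.1
      simpa [N, h0] using h1
    · rw [pow_two]
      exact (mul_le_mul' inf_le_left inf_le_left).trans (homogeneousSubmodule_mul 2 2)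
  have htop : (homogeneousSubmodule (Fin m) ℂ 4).map f = ⊤ := by
    refine eq_top_iff.mpr fun c _ => ⟨c.1 • p + c.2 • q, ?_, ?_⟩
    · exact add_mem (Submodule.smul_mem _ _ hp) (Submodule.smul_mem _ _ hq)
    · simp [hfp, hfq]
  have h := Submodule.finrank_map_add_finrank_inf_ker f (homogeneousSubmodule (Fin m) ℂ 4)
  rw [htop, hsq, finrank_homogeneousSubmodule, finrank_top, Module.finrank_prod,
    Module.finrank_self] at h
  rw [add_comm]
  exact h

end Hyperbolic

/-! ### Ternary sextics -/

section Ternary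

variable {m : ℕ}

/-- For a diagonal quadric of rank three, the apolar polynomials in the three variables that occur
in the quadric form a five-dimensional space, whose triple products span the ternary sextics, a
space of dimension 28. -/
theorem exists_ternary_apolar {P : Finset (Fin m)} (hP : P.card = 3) :
    ∃ U : Submodule ℂ (MvPolynomial (Fin m) ℂ), U ≤ apolar (diagGram P) ∧
      Module.finrank ℂ U = 5 ∧
      Module.finrank ℂ (U ^ 3 : Submodule ℂ (MvPolynomial (Fin m) ℂ)) = 28 ∧
      (∀ a ∈ P, ∀ b ∈ P, a ≠ b → X a * X b ∈ U) ∧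
      (∀ a ∈ P, ∀ b ∈ P, X a * X a - X b * X b ∈ U) := by
  let e : Fin 3 → Fin m := P.orderEmbOfFin hP
  have he : Function.Injective e := (P.orderEmbOfFin hP).injective
  have heP : ∀ a, e a ∈ P := P.orderEmbOfFin_mem hP
  have heP' : ∀ a ∈ P, ∃ i, e i = a := fun a ha => by
    have := P.range_orderEmbOfFin hP
    have h1 : a ∈ Set.range (P.orderEmbOfFin hP) := by rw [this]; exact ha
    exact h1
  let ρ : MvPolynomial (Fin 3) ℂ →ₐ[ℂ] MvPolynomial (Fin m) ℂ := rename e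
  have hρ : Function.Injective ρ.toLinearMap := rename_injective e he
  have hfin : ∀ S : Submodule ℂ (MvPolynomial (Fin 3) ℂ),
      Module.finrank ℂ (S.map ρ.toLinearMap) = Module.finrank ℂ S := fun S =>
    (Submodule.equivMapOfInjective _ hρ S).finrank_eq.symm
  have hcard : 3 ≤ (Finset.univ : Finset (Fin 3)).card := by simp
  refine ⟨(apolar (diagGram Finset.univ)).map ρ.toLinearMap, ?_, ?_, ?_, ?_, ?_⟩
  · rw [Submodule.map_le_iff_le_comap]
    refine apolar_diag_le (Finset.mem_univ 0) _ (fun a b hab => ?_)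
      (fun r hr => absurd (Finset.mem_univ r) hr) (fun a _ => ?_)
    · simpa [ρ] using X_mul_X_mem_apolar_diag P (he.ne hab)
    · simpa [ρ] using X_sq_sub_mem_apolar_diag (heP a) (heP 0)
  · have := finrank_apolar (diagGram_comm (Finset.univ : Finset (Fin 3))) (i := 0) (j := 0)
      (by simp [diagGram])
    rw [hfin]
    have h : (3 + 1).choose 2 = 6 := rfl
    omega
  · rw [← Submodule.map_pow, hfin, apolar_diag_cube hcard, finrank_homogeneousSubmodule]
    rfl
  · intro a ha b hb hab
    obtain ⟨i, rfl⟩ := heP' a ha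
    obtain ⟨j, rfl⟩ := heP' b hb
    exact ⟨X i * X j, X_mul_X_mem_apolar_diag _ (fun h => hab (congrArg e h)), by simp [ρ]⟩
  · intro a ha b hb
    obtain ⟨i, rfl⟩ := heP' a ha
    obtain ⟨j, rfl⟩ := heP' b hb
    exact ⟨X i * X i - X j * X j,
      X_sq_sub_mem_apolar_diag (Finset.mem_univ i) (Finset.mem_univ j), by simp [ρ]⟩

end Ternary

/-! ### Reconstruction of a point on a chart -/

section Charts

variable {m : ℕ} {B : Type*} [CommRing B] [Algebra ℂ B]

/-- The chart of a direction `r` in the radical of the quadric: where `Y (Xᵣ²)` is invertible, the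
quadratic relations make `Y` the evaluation at a point, up to a factor. -/
theorem exists_eval_of_radical_chart {G : Fin m → Fin m → ℂ} (hG : ∀ a b, G a b = G b a)
    {r : Fin m} (hr : ∀ a, G r a = 0) (Y Z : MvPolynomial (Fin m) ℂ →ₗ[ℂ] B)
    (hZ : ∀ p ∈ apolar G, ∀ q ∈ apolar G, Z (p * q) = Y p * Y q)
    (hc : IsUnit (Y (X r * X r))) :
    ∃ (c : B) (u : Fin m → B), ∀ p ∈ apolar G, Y p = c * aeval u p := by
  obtain ⟨c, hc⟩ := hc
  have hrU : ∀ a, X r * X a ∈ apolar G := fun a => X_mul_X_mem_apolar hG (hr a)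
  refine ⟨c, fun a => ↑c⁻¹ * Y (X r * X a), fun p hp => ?_⟩
  set u : Fin m → B := fun a => ↑c⁻¹ * Y (X r * X a) with hu
  have hcu : ∀ a, (c : B) * u a = Y (X r * X a) := fun a => by simp [hu]
  have h : homogeneousSubmodule (Fin m) ℂ 2 ≤ LinearMap.eqLocus
      (Z ∘ₗ LinearMap.mulLeft ℂ (X r * X r)) ((c * c : B) • (aeval u).toLinearMap) := by
    refine homogeneousSubmodule_le_of_prod_X_mem _ fun a => ?_
    rw [Fin.prod_univ_two, LinearMap.mem_eqLocus]
    have h1 : (X r * X r * (X (a 0) * X (a 1)) : MvPolynomial (Fin m) ℂ) =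
        X r * X (a 0) * (X r * X (a 1)) := by ring
    simp only [LinearMap.comp_apply, LinearMap.mulLeft_apply, h1, hZ _ (hrU _) _ (hrU _),
      ← hcu, LinearMap.smul_apply, AlgHom.toLinearMap_apply, map_mul, aeval_X, smul_eq_mul]
    ring
  have h1 : Z (X r * X r * p) = c * c * aeval u p := h hp.1
  rw [hZ _ (hrU r) _ hp, ← hc] at h1
  exact c.isUnit.mul_left_cancel (h1.trans (mul_assoc _ _ _))

/-- The linear form `Xᵢ + εXⱼ`, isotropic for `eᵢ² + eⱼ²` if `ε² = -1`. -/
noncomputable def isoForm (i j : Fin m) (ε : ℂ) : MvPolynomial (Fin m) ℂ := X i + C ε * X j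

theorem C_mul_self {ε : ℂ} (hε : ε * ε = -1) :
    (C ε * C ε : MvPolynomial (Fin m) ℂ) = -1 := by
  rw [← C_mul, hε]; simp

theorem neg_mul_neg_self {ε : ℂ} (hε : ε * ε = -1) : -ε * -ε = -1 := by
  rw [neg_mul_neg, hε]

section Membership

variable {i j k : Fin m} {ε : ℂ} (S : Submodule ℂ (MvPolynomial (Fin m) ℂ))

theorem isoForm_sq_mem (hε : ε * ε = -1) (h1 : X i * X j ∈ S) (h2 : X i * X i - X j * X j ∈ S) :
    isoForm i j ε * isoForm i j ε ∈ S := by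
  have : isoForm i j ε * isoForm i j ε = (X i * X i - X j * X j) + (2 * ε) • (X i * X j) := by
    rw [smul_eq_C_mul, C_mul, isoForm, show (C (2 : ℂ) : MvPolynomial (Fin m) ℂ) = 2 from rfl]
    linear_combination (X j * X j) * C_mul_self (m := m) hε
  rw [this]
  exact add_mem h2 (S.smul_mem _ h1)

theorem isoForm_mul_X_mem (h1 : X i * X k ∈ S) (h2 : X j * X k ∈ S) :
    isoForm i j ε * X k ∈ S := by
  have : isoForm i j ε * X k = X i * X k + ε • (X j * X k) := by
    rw [smul_eq_C_mul, isoForm]; ring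
  rw [this]
  exact add_mem h1 (S.smul_mem _ h2)

theorem isoForm_mul_isoForm_sub_mem (hε : ε * ε = -1) (h1 : X i * X i - X k * X k ∈ S)
    (h2 : X j * X j - X k * X k ∈ S) :
    isoForm i j ε * isoForm i j (-ε) - 2 * (X k * X k) ∈ S := by
  have : isoForm i j ε * isoForm i j (-ε) - 2 * (X k * X k) =
      (X i * X i - X k * X k) + (X j * X j - X k * X k) := by
    rw [isoForm, isoForm, C_neg]
    linear_combination (-(X j * X j)) * C_mul_self (m := m) hε
  rw [this]
  exact add_mem h1 h2

theorem X_mul_X_mem_of_isoForm (hε : ε * ε = -1) (h1 : isoForm i j ε * isoForm i j ε ∈ S)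
    (h2 : isoForm i j (-ε) * isoForm i j (-ε) ∈ S) : X i * X j ∈ S := by
  have : (4 * ε) • (X i * X j) =
      isoForm i j ε * isoForm i j ε - isoForm i j (-ε) * isoForm i j (-ε) := by
    rw [smul_eq_C_mul, C_mul, isoForm, isoForm, C_neg,
      show (C (4 : ℂ) : MvPolynomial (Fin m) ℂ) = 4 from rfl]
    ring
  have h0 : 4 * ε ≠ 0 := by rintro h; simp_all
  rw [← S.smul_mem_iff h0, this]
  exact sub_mem h1 h2

theorem X_sq_sub_X_sq_mem_of_isoForm (hε : ε * ε = -1)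
    (h1 : isoForm i j ε * isoForm i j ε ∈ S)
    (h2 : isoForm i j (-ε) * isoForm i j (-ε) ∈ S) : X i * X i - X j * X j ∈ S := by
  have : (2 : ℂ) • (X i * X i - X j * X j : MvPolynomial (Fin m) ℂ) =
      isoForm i j ε * isoForm i j ε + isoForm i j (-ε) * isoForm i j (-ε) := by
    rw [smul_eq_C_mul, isoForm, isoForm, C_neg,
      show (C (2 : ℂ) : MvPolynomial (Fin m) ℂ) = 2 from rfl]
    linear_combination (-2 * (X j * X j)) * C_mul_self (m := m) hε
  rw [← S.smul_mem_iff (two_ne_zero (α := ℂ)), this]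
  exact add_mem h1 h2

theorem left_X_mul_X_mem_of_isoForm (h1 : isoForm i j ε * X k ∈ S)
    (h2 : isoForm i j (-ε) * X k ∈ S) : X i * X k ∈ S := by
  have : (2 : ℂ) • (X i * X k : MvPolynomial (Fin m) ℂ) =
      isoForm i j ε * X k + isoForm i j (-ε) * X k := by
    rw [smul_eq_C_mul, isoForm, isoForm, C_neg,
      show (C (2 : ℂ) : MvPolynomial (Fin m) ℂ) = 2 from rfl]
    ring
  rw [← S.smul_mem_iff (two_ne_zero (α := ℂ)), this]
  exact add_mem h1 h2

theorem right_X_mul_X_mem_of_isoForm (hε : ε * ε = -1) (h1 : isoForm i j ε * X k ∈ S)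
    (h2 : isoForm i j (-ε) * X k ∈ S) : X j * X k ∈ S := by
  have : (2 * ε) • (X j * X k : MvPolynomial (Fin m) ℂ) =
      isoForm i j ε * X k - isoForm i j (-ε) * X k := by
    rw [smul_eq_C_mul, C_mul, isoForm, isoForm, C_neg,
      show (C (2 : ℂ) : MvPolynomial (Fin m) ℂ) = 2 from rfl]
    ring
  have h0 : 2 * ε ≠ 0 := by rintro h; simp_all
  rw [← S.smul_mem_iff h0, this]
  exact sub_mem h1 h2

theorem left_X_sq_sub_mem_of_isoForm
    (h1 : isoForm i j ε * isoForm i j ε ∈ S) (h2 : isoForm i j (-ε) * isoForm i j (-ε) ∈ S)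
    (h3 : isoForm i j ε * isoForm i j (-ε) - 2 * (X k * X k) ∈ S) :
    X i * X i - X k * X k ∈ S := by
  have : (4 : ℂ) • (X i * X i - X k * X k : MvPolynomial (Fin m) ℂ) =
      isoForm i j ε * isoForm i j ε + isoForm i j (-ε) * isoForm i j (-ε) +
        (2 : ℂ) • (isoForm i j ε * isoForm i j (-ε) - 2 * (X k * X k)) := by
    rw [smul_eq_C_mul, smul_eq_C_mul, isoForm, isoForm, C_neg,
      show (C (4 : ℂ) : MvPolynomial (Fin m) ℂ) = 4 from rfl,
      show (C (2 : ℂ) : MvPolynomial (Fin m) ℂ) = 2 from rfl]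
    ring
  rw [← S.smul_mem_iff (show (4 : ℂ) ≠ 0 by norm_num), this]
  exact add_mem (add_mem h1 h2) (S.smul_mem _ h3)

theorem right_X_sq_sub_mem_of_isoForm (hε : ε * ε = -1)
    (h1 : isoForm i j ε * isoForm i j ε ∈ S) (h2 : isoForm i j (-ε) * isoForm i j (-ε) ∈ S)
    (h3 : isoForm i j ε * isoForm i j (-ε) - 2 * (X k * X k) ∈ S) :
    X j * X j - X k * X k ∈ S := by
  have h4 := left_X_sq_sub_mem_of_isoForm S h1 h2 h3
  have h5 := X_sq_sub_X_sq_mem_of_isoForm S hε h1 h2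
  simpa using sub_mem h4 h5

end Membership

/-- The chart of an isotropic form `e = Xᵢ + εXⱼ` outside the radical. With `e' = Xᵢ - εXⱼ` and
`c = Y (e²)` invertible, the point has coordinates `e ↦ 1`, `Xₗ ↦ Y (eXₗ) / c`, and `e' ↦ τ`, where
`c²τ = c Y (ee' - 2Xₖ²) + 2 Y (eXₖ)²`. The quadratic relations imply all equations for this point
except those for `Y (e'Xₗ)` and `Y (e'²)`, which are assumed here. -/
theorem exists_eval_of_isotropic_chart {P : Finset (Fin m)} {i j k : Fin m} (hi : i ∈ P)
    (hj : j ∈ P) (hk : k ∈ P) (hij : i ≠ j) (hki : k ≠ i) (hkj : k ≠ j) {ε : ℂ}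
    (hε : ε * ε = -1) (Y Z : MvPolynomial (Fin m) ℂ →ₗ[ℂ] B)
    (hZ : ∀ p ∈ apolar (diagGram P), ∀ q ∈ apolar (diagGram P), Z (p * q) = Y p * Y q)
    {c δ : B} (hcY : Y (isoForm i j ε * isoForm i j ε) = c) (hc : IsUnit c)
    (hδ : Y (isoForm i j ε * isoForm i j (-ε) - 2 * (X k * X k)) = δ)
    (h1 : ∀ l, l ≠ i → l ≠ j → c * c * Y (isoForm i j (-ε) * X l) =
      Y (isoForm i j ε * X l) * (c * δ + 2 * Y (isoForm i j ε * X k) ^ 2))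
    (h2 : c * c * c * Y (isoForm i j (-ε) * isoForm i j (-ε)) =
      (c * δ + 2 * Y (isoForm i j ε * X k) ^ 2) ^ 2) :
    ∃ (c : B) (u : Fin m → B), ∀ p ∈ apolar (diagGram P), Y p = c * aeval u p := by
  obtain ⟨d, hd⟩ : ∃ d, c * d = 1 := hc.exists_right_inv
  set U := apolar (diagGram P) with hU
  set v : Fin m → B := fun l => Y (isoForm i j ε * X l) with hv
  set τ : B := d * d * (c * δ + 2 * v k ^ 2) with hτ
  have hcτ : c * c * τ = c * δ + 2 * v k ^ 2 := by
    rw [hτ]; linear_combination (c * δ + 2 * v k ^ 2) * (c * d + 1) * hd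
  let u : Fin m → B := fun a => if a = i then algebraMap ℂ B (1 / 2) * (1 + τ) else
    if a = j then algebraMap ℂ B (-ε / 2) * (1 - τ) else d * v a
  have hui : u i = algebraMap ℂ B (1 / 2) * (1 + τ) := by simp [u]
  have huj : u j = algebraMap ℂ B (-ε / 2) * (1 - τ) := by simp [u, hij.symm]
  have hul : ∀ l, l ≠ i → l ≠ j → c * u l = v l := by
    intro l hli hlj
    simp only [u, hli, hlj, if_false]
    linear_combination v l * hd
  have hhalf : algebraMap ℂ B (1 / 2) + algebraMap ℂ B (1 / 2) = 1 := by
    rw [← map_add]; norm_num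
  have hεhalf : algebraMap ℂ B ε * algebraMap ℂ B (-ε / 2) = algebraMap ℂ B (1 / 2) := by
    rw [← map_mul]
    congr 1
    linear_combination (-1 / 2) * hε
  have hue : aeval u (isoForm i j ε) = 1 := by
    simp only [isoForm, map_add, map_mul, aeval_X, aeval_C, hui, huj]
    linear_combination hhalf + (1 - τ) * hεhalf
  have hue' : aeval u (isoForm i j (-ε)) = τ := by
    simp only [isoForm, map_add, map_mul, aeval_X, aeval_C, hui, huj, map_neg]
    linear_combination τ * hhalf - (1 - τ) * hεhalf
  refine ⟨c, u, fun p hp => ?_⟩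
  have hXX : ∀ {a b}, a ≠ b → X a * X b ∈ U := fun h => X_mul_X_mem_apolar_diag P h
  have hee : isoForm i j ε * isoForm i j ε ∈ U :=
    isoForm_sq_mem U hε (hXX hij) (X_sq_sub_mem_apolar_diag hi hj)
  have hel : ∀ l, l ≠ i → l ≠ j → isoForm i j ε * X l ∈ U := fun l hli hlj =>
    isoForm_mul_X_mem U (hXX hli.symm) (hXX hlj.symm)
  have cancel : ∀ {x y : B}, c * x = c * y → x = y := fun h => hc.mul_left_cancel h
  let S : Submodule ℂ (MvPolynomial (Fin m) ℂ) :=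
    LinearMap.eqLocus Y (c • (aeval u).toLinearMap)
  have hS : ∀ q, q ∈ S ↔ Y q = c * aeval u q := fun q => Iff.rfl
  have hSmul : ∀ q r, q * r ∈ S ↔ Y (q * r) = c * (aeval u q * aeval u r) := fun q r => by
    rw [hS, map_mul (aeval u)]
  -- Multiplication by `e²` turns products of two variables into products of elements of `U`.
  have hprod : ∀ a b, a ≠ i → a ≠ j → b ≠ i → b ≠ j →
      Z (isoForm i j ε * isoForm i j ε * (X a * X b)) = c * c * (u a * u b) := by
    intro a b hai haj hbi hbj
    rw [show isoForm i j ε * isoForm i j ε * (X a * X b) =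
      isoForm i j ε * X a * (isoForm i j ε * X b) by ring,
      hZ _ (hel a hai haj) _ (hel b hbi hbj)]
    change v a * v b = _
    rw [← hul a hai haj, ← hul b hbi hbj]
    ring
  have hS1 : isoForm i j ε * isoForm i j ε ∈ S := by
    rw [hSmul, hcY, hue]; ring
  have hS2 : isoForm i j (-ε) * isoForm i j (-ε) ∈ S := by
    rw [hSmul, hue']
    refine cancel (cancel (cancel ?_))
    linear_combination h2 - (c * c * τ + (c * δ + 2 * v k ^ 2)) * hcτ
  have hS3 : ∀ l, l ≠ i → l ≠ j → isoForm i j ε * X l ∈ S := by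
    intro l hli hlj
    rw [hSmul, hue, aeval_X, one_mul, hul l hli hlj]
  have hS4 : ∀ l, l ≠ i → l ≠ j → isoForm i j (-ε) * X l ∈ S := by
    intro l hli hlj
    rw [hSmul, hue', aeval_X]
    refine cancel (cancel ?_)
    linear_combination h1 l hli hlj - v l * hcτ - (c * c * τ) * hul l hli hlj
  have hS5 : isoForm i j ε * isoForm i j (-ε) - 2 * (X k * X k) ∈ S := by
    rw [hS, hδ, map_sub, map_mul, map_mul, map_mul, hue, hue', aeval_X, map_ofNat]
    refine cancel ?_
    linear_combination -hcτ + 2 * (c * u k + v k) * hul k hki hkj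
  have hS6 : ∀ a b, a ≠ i → a ≠ j → b ≠ i → b ≠ j → X a * X b ∈ U → X a * X b ∈ S := by
    intro a b hai haj hbi hbj hab
    rw [hSmul]
    refine cancel ?_
    have := hprod a b hai haj hbi hbj
    rw [hZ _ hee _ hab, hcY] at this
    rw [this, aeval_X, aeval_X]
    ring
  refine apolar_diag_le hk S (fun a b hab => ?_) (fun r hr => ?_) (fun a ha => ?_) hp
  · by_cases hai : a = i
    · subst hai
      by_cases hbj : b = j
      · subst hbj
        exact X_mul_X_mem_of_isoForm S hε hS1 hS2
      · exact left_X_mul_X_mem_of_isoForm S (hS3 b hab.symm hbj) (hS4 b hab.symm hbj)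
    by_cases haj : a = j
    · subst haj
      by_cases hbi : b = i
      · subst hbi
        rw [mul_comm]
        exact X_mul_X_mem_of_isoForm S hε hS1 hS2
      · exact right_X_mul_X_mem_of_isoForm S hε (hS3 b hbi hab.symm) (hS4 b hbi hab.symm)
    by_cases hbi : b = i
    · subst hbi
      rw [mul_comm]
      exact left_X_mul_X_mem_of_isoForm S (hS3 a hai haj) (hS4 a hai haj)
    by_cases hbj : b = j
    · subst hbj
      rw [mul_comm]
      exact right_X_mul_X_mem_of_isoForm S hε (hS3 a hai haj) (hS4 a hai haj)
    exact hS6 a b hai haj hbi hbj (hXX hab)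
  · have hri : r ≠ i := fun h => hr (h ▸ hi)
    have hrj : r ≠ j := fun h => hr (h ▸ hj)
    exact hS6 r r hri hrj hri hrj (X_sq_mem_apolar_diag hr)
  · by_cases hai : a = i
    · subst hai
      exact left_X_sq_sub_mem_of_isoForm S hS1 hS2 hS5
    by_cases haj : a = j
    · subst haj
      exact right_X_sq_sub_mem_of_isoForm S hε hS1 hS2 hS5
    rw [hS]
    refine cancel ?_
    have h3 : Z (isoForm i j ε * isoForm i j ε * (X a * X a - X k * X k)) =
        c * c * (u a * u a) - c * c * (u k * u k) := by
      rw [mul_sub, map_sub, hprod a a hai haj hai haj, hprod k k hki hkj hki hkj]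
    rw [hZ _ hee _ (X_sq_sub_mem_apolar_diag ha hk), hcY] at h3
    rw [h3, map_sub, map_mul, map_mul, aeval_X, aeval_X]
    ring

/-- On the chart of an isotropic form `Xᵢ + εXⱼ`, the quadratic relations, for a quadric of rank
three together with the ternary cubic relations, make `Y` the evaluation at a point, up to a
factor. -/
theorem exists_eval_of_isUnit_isoForm {P : Finset (Fin m)} (hP : 3 ≤ P.card) {i j : Fin m}
    (hi : i ∈ P) (hj : j ∈ P) (hij : i ≠ j) {ε : ℂ} (hε : ε * ε = -1)
    (Y Z : MvPolynomial (Fin m) ℂ →ₗ[ℂ] B)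
    (hZ : ∀ p ∈ apolar (diagGram P), ∀ q ∈ apolar (diagGram P), Z (p * q) = Y p * Y q)
    (hcub : P.card = 3 → ∃ (U : Submodule ℂ (MvPolynomial (Fin m) ℂ))
      (T : MvPolynomial (Fin m) ℂ →ₗ[ℂ] B), (∀ a ∈ P, ∀ b ∈ P, a ≠ b → X a * X b ∈ U) ∧
      (∀ a ∈ P, ∀ b ∈ P, X a * X a - X b * X b ∈ U) ∧
      ∀ p ∈ U, ∀ q ∈ U, ∀ r ∈ U, T (p * q * r) = Y p * Y q * Y r)
    (hc : IsUnit (Y (isoForm i j ε * isoForm i j ε))) :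
    ∃ (c : B) (u : Fin m → B), ∀ p ∈ apolar (diagGram P), Y p = c * aeval u p := by
  obtain ⟨k, hk, hk'⟩ := Finset.exists_mem_notMem_of_card_lt_card
    (s := {i, j}) (t := P) ((Finset.card_le_two).trans_lt hP)
  obtain ⟨hki, hkj⟩ : k ≠ i ∧ k ≠ j := by simpa using hk'
  set U := apolar (diagGram P) with hU
  have hXX : ∀ {a b}, a ≠ b → X a * X b ∈ U := fun h => X_mul_X_mem_apolar_diag P h
  have hee : isoForm i j ε * isoForm i j ε ∈ U :=
    isoForm_sq_mem U hε (hXX hij) (X_sq_sub_mem_apolar_diag hi hj)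
  have hee' : isoForm i j (-ε) * isoForm i j (-ε) ∈ U :=
    isoForm_sq_mem U (neg_mul_neg_self hε) (hXX hij) (X_sq_sub_mem_apolar_diag hi hj)
  have hel : ∀ {ε} l, l ≠ i → l ≠ j → isoForm i j ε * X l ∈ U := fun l hli hlj =>
    isoForm_mul_X_mem U (hXX hli.symm) (hXX hlj.symm)
  have hδl : ∀ l ∈ P, isoForm i j ε * isoForm i j (-ε) - 2 * (X l * X l) ∈ U := fun l hl =>
    isoForm_mul_isoForm_sub_mem U hε (X_sq_sub_mem_apolar_diag hi hl)
      (X_sq_sub_mem_apolar_diag hj hl)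
  set c := Y (isoForm i j ε * isoForm i j ε) with hcdef
  set δ := Y (isoForm i j ε * isoForm i j (-ε) - 2 * (X k * X k)) with hδ
  set v : Fin m → B := fun l => Y (isoForm i j ε * X l) with hv
  have hprod : ∀ a b, a ≠ i → a ≠ j → b ≠ i → b ≠ j →
      Z (isoForm i j ε * isoForm i j ε * (X a * X b)) = v a * v b := by
    intro a b hai haj hbi hbj
    rw [show isoForm i j ε * isoForm i j ε * (X a * X b) =
      isoForm i j ε * X a * (isoForm i j ε * X b) by ring,
      hZ _ (hel a hai haj) _ (hel b hbi hbj)]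
  have hcprod : ∀ a b, a ≠ i → a ≠ j → b ≠ i → b ≠ j → a ≠ b →
      c * Y (X a * X b) = v a * v b := by
    intro a b hai haj hbi hbj hab
    rw [← hprod a b hai haj hbi hbj, hZ _ hee _ (hXX hab)]
  have hcδ : ∀ l ∈ P, l ≠ i → l ≠ j →
      c * Y (isoForm i j ε * isoForm i j (-ε) - 2 * (X l * X l)) =
        c * δ + 2 * v k ^ 2 - 2 * v l ^ 2 := by
    intro l hl hli hlj
    have h1 : isoForm i j ε * isoForm i j (-ε) - 2 * (X l * X l) =
        (isoForm i j ε * isoForm i j (-ε) - 2 * (X k * X k)) +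
          ((X k * X k - X l * X l) + (X k * X k - X l * X l)) := by ring
    have h2 : c * Y (X k * X k - X l * X l) = v k * v k - v l * v l := by
      rw [← hprod k k hki hkj hki hkj, ← hprod l l hli hlj hli hlj, ← map_sub, ← mul_sub,
        hZ _ hee _ (X_sq_sub_mem_apolar_diag hk hl)]
    rw [h1, map_add, map_add]
    linear_combination 2 * h2
  -- The equation for `Y (e'Xₗ)` from a further index `l'`.
  have quad1 : ∀ l, l ≠ i → l ≠ j → ∀ l' ∈ P, l' ≠ i → l' ≠ j → l' ≠ l →
      c * c * Y (isoForm i j (-ε) * X l) = v l * (c * δ + 2 * v k ^ 2) := by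
    intro l hli hlj l' hl' hl'i hl'j hl'l
    have h1 : c * Y (isoForm i j (-ε) * X l) =
        v l * Y (isoForm i j ε * isoForm i j (-ε) - 2 * (X l' * X l')) +
          (v l' * Y (X l' * X l) + v l' * Y (X l' * X l)) := by
      simp only [hcdef, hv]
      rw [← hZ _ hee _ (hel l hli hlj), ← hZ _ (hel l hli hlj) _ (hδl l' hl'),
        ← hZ _ (hel l' hl'i hl'j) _ (hXX hl'l), ← map_add, ← map_add]
      congr 1
      ring
    linear_combination c * h1 + v l * hcδ l' hl' hl'i hl'j +
      2 * v l' * hcprod l' l hl'i hl'j hli hlj hl'l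
  rcases hP.lt_or_eq with h4 | h3
  · obtain ⟨l, hl, hl'⟩ := Finset.exists_mem_notMem_of_card_lt_card
      (s := {i, j, k}) (t := P) ((Finset.card_le_three).trans_lt h4)
    obtain ⟨hli, hlj, hlk⟩ : l ≠ i ∧ l ≠ j ∧ l ≠ k := by simpa using hl'
    have E1 : ∀ a, a ≠ i → a ≠ j →
        c * c * Y (isoForm i j (-ε) * X a) = v a * (c * δ + 2 * v k ^ 2) := by
      intro a hai haj
      by_cases hka : k = a
      · exact quad1 a hai haj l hl hli hlj (hka ▸ hlk)
      · exact quad1 a hai haj k hk hki hkj hka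
    refine exists_eval_of_isotropic_chart hi hj hk hij hki hkj hε Y Z hZ hcdef.symm hc hδ.symm E1 ?_
    have h1 : c * Y (isoForm i j (-ε) * isoForm i j (-ε)) =
        δ * Y (isoForm i j ε * isoForm i j (-ε) - 2 * (X l * X l)) +
          (v k * Y (isoForm i j (-ε) * X k) + v k * Y (isoForm i j (-ε) * X k)) +
          (v l * Y (isoForm i j (-ε) * X l) + v l * Y (isoForm i j (-ε) * X l)) -
          (Y (X k * X l) * Y (X k * X l) + Y (X k * X l) * Y (X k * X l)) -
          (Y (X k * X l) * Y (X k * X l) + Y (X k * X l) * Y (X k * X l)) := by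
      simp only [hcdef, hv, hδ]
      rw [← hZ _ hee _ hee', ← hZ _ (hδl k hk) _ (hδl l hl), ← hZ _ (hel k hki hkj) _
        (hel k hki hkj), ← hZ _ (hel l hli hlj) _ (hel l hli hlj), ← hZ _ (hXX hlk.symm) _
        (hXX hlk.symm), ← map_add, ← map_add, ← map_add, ← map_add, ← map_add, ← map_sub,
        ← map_sub]
      congr 1
      ring
    linear_combination c * c * h1 + c * δ * hcδ l hl hli hlj + 2 * v k * E1 k hki hkj +
      2 * v l * E1 l hli hlj -
      4 * (c * Y (X k * X l) + v k * v l) * hcprod k l hki hkj hli hlj hlk.symm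
  · -- For rank three, `k` is the only further index, and cubic relations take over.
    obtain ⟨V, T, hV1, hV2, hT⟩ := hcub h3.symm
    have kee : isoForm i j ε * isoForm i j ε ∈ V :=
      isoForm_sq_mem V hε (hV1 i hi j hj hij) (hV2 i hi j hj)
    have kee' : isoForm i j (-ε) * isoForm i j (-ε) ∈ V :=
      isoForm_sq_mem V (neg_mul_neg_self hε) (hV1 i hi j hj hij) (hV2 i hi j hj)
    have kel : ∀ {ε}, isoForm i j ε * X k ∈ V :=
      isoForm_mul_X_mem V (hV1 i hi k hk hki.symm) (hV1 j hj k hk hkj.symm)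
    have kδ : isoForm i j ε * isoForm i j (-ε) - 2 * (X k * X k) ∈ V :=
      isoForm_mul_isoForm_sub_mem V hε (hV2 i hi k hk) (hV2 j hj k hk)
    have E1 : ∀ a, a ≠ i → a ≠ j →
        c * c * Y (isoForm i j (-ε) * X a) = v a * (c * δ + 2 * v k ^ 2) := by
      intro a hai haj
      by_cases hka : k = a
      · subst hka
        have h1 : c * c * Y (isoForm i j (-ε) * X k) =
            c * v k * δ + (v k * v k * v k + v k * v k * v k) := by
          simp only [hcdef, hv, hδ]
          rw [← hT _ kee _ kee _ kel, ← hT _ kee _ kel _ kδ, ← hT _ kel _ kel _ kel, ← map_add,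
            ← map_add]
          congr 1
          ring
        linear_combination h1
      · exact quad1 a hai haj k hk hki hkj hka
    refine exists_eval_of_isotropic_chart hi hj hk hij hki hkj hε Y Z hZ hcdef.symm hc hδ.symm E1 ?_
    have h1 : c * c * Y (isoForm i j (-ε) * isoForm i j (-ε)) =
        c * δ * δ + (c * v k * Y (isoForm i j (-ε) * X k) +
          c * v k * Y (isoForm i j (-ε) * X k)) + (v k * v k * δ + v k * v k * δ) := by
      simp only [hcdef, hv, hδ]
      rw [← hT _ kee _ kee _ kee', ← hT _ kee _ kδ _ kδ, ← hT _ kee _ kel _ kel,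
        ← hT _ kel _ kel _ kδ, ← map_add, ← map_add, ← map_add, ← map_add]
      congr 1
      ring
    linear_combination c * h1 + 2 * v k * E1 k hki hkj

/-- The charts of isotropic forms and of radical directions cover everything: a radical ideal that
contains all the coordinates defining these charts contains all of `Y U`. -/
theorem map_mem_of_charts_mem {P : Finset (Fin m)} (hP : 2 ≤ P.card)
    (Y Z : MvPolynomial (Fin m) ℂ →ₗ[ℂ] B)
    (hZ : ∀ p ∈ apolar (diagGram P), ∀ q ∈ apolar (diagGram P), Z (p * q) = Y p * Y q)
    (I : Ideal B) (hI : I.IsRadical)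
    (h1 : ∀ i ∈ P, ∀ j ∈ P, i ≠ j → ∀ ε : ℂ, ε * ε = -1 →
      Y (isoForm i j ε * isoForm i j ε) ∈ I)
    (h2 : ∀ r, r ∉ P → Y (X r * X r) ∈ I) : ∀ p ∈ apolar (diagGram P), Y p ∈ I := by
  have hXX : ∀ {a b}, a ≠ b → X a * X b ∈ apolar (diagGram P) := fun h =>
    X_mul_X_mem_apolar_diag P h
  let S : Submodule ℂ (MvPolynomial (Fin m) ℂ) := (I.restrictScalars ℂ).comap Y
  -- The square of the product of two forms is the product of their squares.
  have hsq : ∀ p q : MvPolynomial (Fin m) ℂ, p * p ∈ apolar (diagGram P) →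
      q * q ∈ apolar (diagGram P) → p * q ∈ apolar (diagGram P) → q * q ∈ S → p * q ∈ S := by
    intro p q hp hq hpq h
    refine hI ⟨2, ?_⟩
    rw [pow_two, ← hZ _ hpq _ hpq, show p * q * (p * q) = p * p * (q * q) by ring, hZ _ hp _ hq]
    exact I.mul_mem_left _ h
  obtain ⟨k, hk⟩ : P.Nonempty := Finset.card_pos.mp (by omega)
  have hne : ∀ a, ∃ j ∈ P, j ≠ a := fun a => by
    obtain ⟨j, hj, hj'⟩ := Finset.exists_mem_notMem_of_card_lt_card
      (s := {a}) (t := P) (by simp; omega)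
    exact ⟨j, hj, by simpa using hj'⟩
  have hII : Complex.I * Complex.I = -1 := Complex.I_mul_I
  have hrad : ∀ a r, r ∉ P → a ≠ r → X a * X r ∈ S := by
    intro a r hr har
    by_cases ha : a ∈ P
    · obtain ⟨j, hj, hja⟩ := hne a
      have key : ∀ ε : ℂ, ε * ε = -1 → isoForm a j ε * X r ∈ S := fun ε hε =>
        hsq _ _ (isoForm_sq_mem _ hε (hXX hja.symm) (X_sq_sub_mem_apolar_diag ha hj))
          (X_sq_mem_apolar_diag hr)
          (isoForm_mul_X_mem _ (hXX har) (hXX fun h => hr (h ▸ hj))) (h2 r hr)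
      exact left_X_mul_X_mem_of_isoForm S (key _ hII) (key _ (neg_mul_neg_self hII))
    · exact hsq _ _ (X_sq_mem_apolar_diag ha) (X_sq_mem_apolar_diag hr) (hXX har) (h2 r hr)
  refine apolar_diag_le hk S (fun a b hab => ?_) h2 (fun a ha => ?_)
  · by_cases hb : b ∈ P
    · by_cases ha : a ∈ P
      · exact X_mul_X_mem_of_isoForm S hII (h1 a ha b hb hab _ hII)
          (h1 a ha b hb hab _ (neg_mul_neg_self hII))
      · rw [mul_comm]
        exact hrad b a ha hab.symm
    · exact hrad a b hb hab
  · by_cases hak : a = k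
    · subst hak; simp
    · exact X_sq_sub_X_sq_mem_of_isoForm S hII (h1 a ha k hk hak _ hII)
        (h1 a ha k hk hak _ (neg_mul_neg_self hII))

end Charts

/-! ### Forms that cut out the image -/

section Forms

variable {m : ℕ}

theorem aeval_mul_of_mem_homogeneousSubmodule_two {p : MvPolynomial (Fin m) ℂ}
    (hp : p ∈ homogeneousSubmodule (Fin m) ℂ 2) (d : ℂ) (w : Fin m → ℂ) :
    aeval (fun i => d * w i) p = d * d * aeval w p := by
  have h : homogeneousSubmodule (Fin m) ℂ 2 ≤ LinearMap.eqLocus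
      (aeval (fun i => d * w i)).toLinearMap ((d * d) • (aeval w).toLinearMap) := by
    refine homogeneousSubmodule_le_of_prod_X_mem _ fun a => ?_
    rw [LinearMap.mem_eqLocus]
    simp only [Fin.prod_univ_two, AlgHom.toLinearMap_apply, map_mul, aeval_X,
      LinearMap.smul_apply, smul_eq_mul]
    ring
  exact h hp

theorem aeval_aeval_mul_rename {n : ℕ} (x : Fin (n + 1) → MvPolynomial (Fin m) ℂ)
    (f : CoordRing n) {A : Type*} [CommRing A] [Algebra ℂ A] (t : Option (Fin m) → A) :
    aeval t (aeval (fun i => X none * rename some (x i)) f) =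
      aeval (fun i => t none * aeval (fun j => t (some j)) (x i)) f := by
  have : (aeval t).comp (aeval (fun i => X none * rename some (x i))) =
      aeval (R := ℂ) (fun i => t none * aeval (fun j => t (some j)) (x i)) := by
    ext i; simp [aeval_rename, Function.comp_def]
  exact DFunLike.congr_fun this f

/-- A polynomial that vanishes identically on the quadratic polynomials `xᵢ` vanishes on all their
multiples, in any algebra: over `ℂ` the factor is a square, hence can be moved into the point. -/
theorem aeval_mul_eq_zero {n : ℕ} {x : Fin (n + 1) → MvPolynomial (Fin m) ℂ}
    (hx : ∀ i, x i ∈ homogeneousSubmodule (Fin m) ℂ 2) {f : CoordRing n} (hf : aeval x f = 0)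
    {B : Type*} [CommRing B] [Algebra ℂ B] (c : B) (u : Fin m → B) :
    aeval (fun i => c * aeval u (x i)) f = 0 := by
  let F : MvPolynomial (Option (Fin m)) ℂ := aeval (fun i => X none * rename some (x i)) f
  have h0 : F = 0 := by
    refine MvPolynomial.funext fun t => ?_
    rw [map_zero, ← coe_aeval_eq_eval, RingHom.coe_coe, aeval_aeval_mul_rename]
    obtain ⟨d, hd⟩ := IsAlgClosed.exists_eq_mul_self (t none)
    have h1 : (fun i => t none * aeval (fun j => t (some j)) (x i)) =
        fun i => aeval (fun j => d * t (some j)) (x i) := by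
      funext i
      rw [aeval_mul_of_mem_homogeneousSubmodule_two (hx i), hd]
    have h2 : (aeval (fun j => d * t (some j))).comp (aeval x) =
        aeval (R := ℂ) (fun i => aeval (fun j => d * t (some j)) (x i)) := by
      ext i; simp
    rw [h1, ← h2, AlgHom.comp_apply, hf, map_zero]
  have := aeval_aeval_mul_rename x f fun o => o.elim c u
  rw [show aeval _ f = F from rfl, h0, map_zero] at this
  exact this.symm

/-- If on the chart where `g` is invertible the coordinates `Y (xᵢ)` are those of a multiple of a
point, then a power of `g` kills every polynomial relation among the `xᵢ`, evaluated at the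
`Y (xᵢ)`. -/
theorem mem_radical_annihilator_of_chart {n : ℕ} {x : Fin (n + 1) → MvPolynomial (Fin m) ℂ}
    (hx : ∀ i, x i ∈ homogeneousSubmodule (Fin m) ℂ 2) {f : CoordRing n} (hf : aeval x f = 0)
    {B : Type*} [CommRing B] [Algebra ℂ B] (ξ : Fin (n + 1) → B) (g : B)
    (h : ∃ (c : Localization.Away g) (u : Fin m → Localization.Away g),
      ∀ i, algebraMap B (Localization.Away g) (ξ i) = c * aeval u (x i)) :
    g ∈ (Submodule.annihilator (Ideal.span {aeval ξ f})).radical := by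
  obtain ⟨c, u, h⟩ := h
  have h1 : algebraMap B (Localization.Away g) (aeval ξ f) = 0 := by
    have := aeval_mul_eq_zero hx hf c u
    simp only [← h] at this
    rw [← this]
    exact (aeval_algebraMap_apply _ ξ f).symm
  obtain ⟨⟨_, N, rfl⟩, hN⟩ := (IsLocalization.map_eq_zero_iff (Submonoid.powers g)
    (Localization.Away g) _).mp h1
  exact ⟨N, Submodule.mem_annihilator_span_singleton _ _ |>.mpr hN⟩

/-- Over `ℂ`, the quadratic relations of the rank two quadric `2eᵢeⱼ` already force `Y` to be the
evaluation at a point, up to a factor: if `Y (Xᵣ²) = 0` for all directions `r` of the radical, then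
all products with `Xᵣ` vanish, and only `Y (Xᵢ²)` and `Y (Xⱼ²)` remain. -/
theorem exists_eval_of_hyp {i j : Fin m} (hij : i ≠ j)
    (Y Z : MvPolynomial (Fin m) ℂ →ₗ[ℂ] ℂ)
    (hZ : ∀ p ∈ apolar (hypGram i j), ∀ q ∈ apolar (hypGram i j), Z (p * q) = Y p * Y q) :
    ∃ (c : ℂ) (u : Fin m → ℂ), ∀ p ∈ apolar (hypGram i j), Y p = c * aeval u p := by
  by_cases hrad : ∃ r, r ≠ i ∧ r ≠ j ∧ Y (X r * X r) ≠ 0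
  · obtain ⟨r, hri, hrj, hr⟩ := hrad
    exact exists_eval_of_radical_chart (hypGram_comm i j)
      (fun a => hypGram_eq_zero (by grind)) Y Z hZ hr.isUnit
  push Not at hrad
  obtain ⟨α, hα⟩ := IsAlgClosed.exists_eq_mul_self (Y (X i * X i))
  obtain ⟨β, hβ⟩ := IsAlgClosed.exists_eq_mul_self (Y (X j * X j))
  have hmem : ∀ {a b : Fin m}, ¬((a = i ∧ b = j) ∨ (a = j ∧ b = i)) →
      X a * X b ∈ apolar (hypGram i j) := fun h =>
    X_mul_X_mem_apolar (hypGram_comm i j) (hypGram_eq_zero h)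
  have hzero : ∀ a r, r ≠ i → r ≠ j → Y (X a * X r) = 0 := by
    intro a r hri hrj
    have h1 : X a * X r ∈ apolar (hypGram i j) := hmem (by grind)
    have h2 : Y (X a * X r) * Y (X a * X r) = 0 := by
      rw [← hZ _ h1 _ h1, show (X a * X r * (X a * X r) : MvPolynomial (Fin m) ℂ) =
        X a * X a * (X r * X r) by ring, hZ _ (hmem (by grind)) _ (hmem (by grind)),
        hrad r hri hrj, mul_zero]
    simpa using h2
  let u : Fin m → ℂ := fun a => if a = i then α else if a = j then β else 0
  refine ⟨1, u, fun p hp => ?_⟩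
  have hle : apolar (hypGram i j) ≤ LinearMap.eqLocus Y (aeval u).toLinearMap := by
    refine apolar_hyp_le i j _ fun a b hab => ?_
    rw [LinearMap.mem_eqLocus, AlgHom.toLinearMap_apply, map_mul (aeval u), aeval_X, aeval_X]
    by_cases hb : b ≠ i ∧ b ≠ j
    · rw [hzero a b hb.1 hb.2]; simp [u, hb]
    by_cases ha : a ≠ i ∧ a ≠ j
    · rw [mul_comm, hzero b a ha.1 ha.2]; simp [u, ha]
    have : (a = i ∧ b = i) ∨ (a = j ∧ b = j) := by grind
    rcases this with ⟨rfl, rfl⟩ | ⟨rfl, rfl⟩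
    · simpa [u] using hα
    · simpa [u, hij.symm] using hβ
  rw [one_mul]
  exact hle hp

/-- A point of the form `c • (xᵢ(u))` is of the form `xᵢ(w)`, as `c` is a square. -/
theorem exists_eq_aeval_of_eq_mul {n : ℕ} {x : Fin (n + 1) → MvPolynomial (Fin m) ℂ}
    (hx : ∀ i, x i ∈ homogeneousSubmodule (Fin m) ℂ 2) {ξ : Fin (n + 1) → ℂ}
    (h : ∃ (c : ℂ) (u : Fin m → ℂ), ∀ i, ξ i = c * aeval u (x i)) :
    ∃ w : Fin m → ℂ, ∀ i, ξ i = aeval w (x i) := by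
  obtain ⟨c, u, h⟩ := h
  obtain ⟨d, rfl⟩ := IsAlgClosed.exists_eq_mul_self c
  exact ⟨fun i => d * u i, fun i => by
    rw [h, aeval_mul_of_mem_homogeneousSubmodule_two (hx i)]⟩

/-- The rank two case: linear and quadratic forms that cut out, as a set, the image of
`w ↦ (xᵢ(w))ᵢ`. -/
theorem exists_forms_of_hyp {n : ℕ} {x : Fin (n + 1) → MvPolynomial (Fin m) ℂ} {i j : Fin m}
    (hij : i ≠ j) (hx : Submodule.span ℂ (Set.range x) = apolar (hypGram i j)) :
    ∃ (a b r : ℕ) (lin : Fin a → CoordRing n) (quad : Fin b → CoordRing n),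
      a + r = n + 1 ∧ r + 1 = (m + 1).choose 2 ∧
      b + (m + 3).choose 4 = (r + 1).choose 2 + 2 ∧
      IsFormSystem 1 lin ∧ IsFormSystem 2 quad ∧
      (∀ f ∈ Set.range lin ∪ Set.range quad, aeval x f = 0) ∧
      ∀ ξ : Fin (n + 1) → ℂ, (∀ f ∈ Set.range lin ∪ Set.range quad, aeval ξ f = 0) →
        ∃ w : Fin m → ℂ, ∀ t, ξ t = aeval w (x t) := by
  obtain ⟨a, lin, hlin, ha, hlin0, hY⟩ := exists_linear_relations x
  obtain ⟨b, quad, hquad, hb, hquad0, hZ⟩ := exists_relations x _ hx.ge 2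
  have hxU : ∀ t, x t ∈ apolar (hypGram i j) := fun t => hx ▸ Submodule.subset_span ⟨t, rfl⟩
  have hr := finrank_apolar (hypGram_comm i j) (i := i) (j := j) (by simp [hypGram_self])
  have hsq := finrank_apolar_hyp_sq hij
  rw [hx] at ha
  refine ⟨a, b, _, lin, quad, ha, hr, ?_, hlin, hquad, ?_, fun ξ h => ?_⟩
  · simp only [Nat.add_succ_sub_one] at hb
    omega
  · rintro f (⟨t, rfl⟩ | ⟨t, rfl⟩)
    exacts [hlin0 t, hquad0 t]
  · obtain ⟨Y, hYξ⟩ := hY ℂ ξ fun t => h _ (Or.inl ⟨t, rfl⟩)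
    obtain ⟨Z, hZY⟩ := hZ ℂ ξ Y hYξ fun t => h _ (Or.inr ⟨t, rfl⟩)
    obtain ⟨c, u, hcu⟩ := exists_eval_of_hyp hij Y Z fun p hp q hq => by
      simpa using hZY ![p, q] (by simp [Fin.forall_fin_two, hp, hq])
    exact exists_eq_aeval_of_eq_mul (fun i => (hxU i).1)
      ⟨c, u, fun i => by rw [← hYξ, hcu _ (hxU i)]⟩

/-- The case of rank at least three: linear, quadratic and cubic forms that cut out the image of
`w ↦ (xᵢ(w))ᵢ`, up to multiplication by powers of the coordinates. -/
theorem exists_forms_of_diag {n : ℕ} {x : Fin (n + 1) → MvPolynomial (Fin m) ℂ}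
    {P : Finset (Fin m)} (hP : 3 ≤ P.card)
    (hx : Submodule.span ℂ (Set.range x) = apolar (diagGram P)) :
    ∃ (a b c r : ℕ) (lin : Fin a → CoordRing n) (quad : Fin b → CoordRing n)
      (cub : Fin c → CoordRing n),
      a + r = n + 1 ∧ r + 1 = (m + 1).choose 2 ∧ b + (m + 3).choose 4 = (r + 1).choose 2 ∧
      c = (if P.card = 3 then 7 else 0) ∧
      IsFormSystem 1 lin ∧ IsFormSystem 2 quad ∧ IsFormSystem 3 cub ∧
      (∀ f ∈ Set.range lin ∪ Set.range quad ∪ Set.range cub, aeval x f = 0) ∧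
      (∀ ξ : Fin (n + 1) → ℂ, ξ ≠ 0 →
        (∀ f ∈ Set.range lin ∪ Set.range quad ∪ Set.range cub, aeval ξ f = 0) →
        ∃ w : Fin m → ℂ, ∀ i, ξ i = aeval w (x i)) ∧
      ∀ f : CoordRing n, aeval x f = 0 → ∀ i, ∃ N : ℕ,
        X i ^ N * f ∈ Ideal.span (Set.range lin ∪ Set.range quad ∪ Set.range cub) := by
  obtain ⟨a, lin, hlin, ha, hlin0, hY⟩ := exists_linear_relations x
  obtain ⟨b, quad, hquad, hb, hquad0, hZ⟩ := exists_relations x _ hx.ge 2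
  have hxU : ∀ i, x i ∈ apolar (diagGram P) := fun i => hx ▸ Submodule.subset_span ⟨i, rfl⟩
  have hxH : ∀ i, x i ∈ homogeneousSubmodule (Fin m) ℂ 2 := fun i => (hxU i).1
  obtain ⟨k, hk⟩ : P.Nonempty := Finset.card_pos.mp (by omega)
  have hr := finrank_apolar (diagGram_comm P) (i := k) (j := k)
    (by simp [diagGram_self_of_mem hk])
  rw [apolar_diag_sq hP, finrank_homogeneousSubmodule] at hb
  rw [hx] at ha
  obtain ⟨c, cub, hc, hcub, hcub0, hT⟩ : ∃ (c : ℕ) (cub : Fin c → CoordRing n),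
      c = (if P.card = 3 then 7 else 0) ∧ IsFormSystem 3 cub ∧ (∀ t, aeval x (cub t) = 0) ∧
      ∀ (B : Type) [CommRing B] [Algebra ℂ B] (ξ : Fin (n + 1) → B)
        (Y : MvPolynomial (Fin m) ℂ →ₗ[ℂ] B), (∀ i, Y (x i) = ξ i) →
        (∀ t, aeval ξ (cub t) = 0) → P.card = 3 →
        ∃ (U : Submodule ℂ (MvPolynomial (Fin m) ℂ)) (T : MvPolynomial (Fin m) ℂ →ₗ[ℂ] B),
          (∀ a ∈ P, ∀ b ∈ P, a ≠ b → X a * X b ∈ U) ∧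
          (∀ a ∈ P, ∀ b ∈ P, X a * X a - X b * X b ∈ U) ∧
          ∀ p ∈ U, ∀ q ∈ U, ∀ r ∈ U, T (p * q * r) = Y p * Y q * Y r := by
    by_cases h3 : P.card = 3
    · obtain ⟨U, hU, hU5, hU28, hU1, hU2⟩ := exists_ternary_apolar h3
      obtain ⟨c, cub, hcub, hc, hcub0, hT⟩ := exists_relations x U (hx ▸ hU) 3
      refine ⟨c, cub, ?_, hcub, hcub0, fun B _ _ ξ Y hξ h _ => ?_⟩
      · have h35 : (5 + 3 - 1).choose 3 = 35 := rfl
        rw [hU5, hU28, h35] at hc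
        rw [if_pos h3]
        omega
      · obtain ⟨T, hT⟩ := hT B ξ Y hξ h
        refine ⟨U, T, hU1, hU2, fun p hp q hq r hr => ?_⟩
        simpa [Fin.prod_univ_three] using hT ![p, q, r] (by
          intro t; fin_cases t <;> assumption)
    · exact ⟨0, Fin.elim0, by simp [h3], ⟨fun t => t.elim0, linearIndependent_empty_type⟩,
        fun t => t.elim0, fun B _ _ ξ Y _ _ h => absurd h h3⟩
  -- The relations determine the point on every chart.
  have charts : ∀ (B : Type) [CommRing B] [Algebra ℂ B] (ξ : Fin (n + 1) → B)
      (Y : MvPolynomial (Fin m) ℂ →ₗ[ℂ] B), (∀ t, Y (x t) = ξ t) →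
      (∀ f ∈ Set.range lin ∪ Set.range quad ∪ Set.range cub, aeval ξ f = 0) →
      ∃ Z : MvPolynomial (Fin m) ℂ →ₗ[ℂ] B,
        (∀ p ∈ apolar (diagGram P), ∀ q ∈ apolar (diagGram P), Z (p * q) = Y p * Y q) ∧
        (∀ i ∈ P, ∀ j ∈ P, i ≠ j → ∀ ε : ℂ, ε * ε = -1 →
          IsUnit (Y (isoForm i j ε * isoForm i j ε)) →
          ∃ (c : B) (u : Fin m → B), ∀ t, ξ t = c * aeval u (x t)) ∧
        ∀ r, r ∉ P → IsUnit (Y (X r * X r)) →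
          ∃ (c : B) (u : Fin m → B), ∀ t, ξ t = c * aeval u (x t) := by
    intro B _ _ ξ Y hYξ h
    obtain ⟨Z, hZY⟩ := hZ B ξ Y hYξ fun t => h _ (Or.inl (Or.inr ⟨t, rfl⟩))
    have hZY' : ∀ p ∈ apolar (diagGram P), ∀ q ∈ apolar (diagGram P),
        Z (p * q) = Y p * Y q := fun p hp q hq => by
      simpa using hZY ![p, q] (by simp [Fin.forall_fin_two, hp, hq])
    refine ⟨Z, hZY', fun i hi j hj hij ε hε hu => ?_, fun r hr hu => ?_⟩
    · obtain ⟨c, u, hcu⟩ := exists_eval_of_isUnit_isoForm hP hi hj hij hε Y Z hZY'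
        (hT B ξ Y hYξ fun t => h _ (Or.inr ⟨t, rfl⟩)) hu
      exact ⟨c, u, fun i => by rw [← hYξ, hcu _ (hxU i)]⟩
    · obtain ⟨c, u, hcu⟩ := exists_eval_of_radical_chart (diagGram_comm P) (r := r)
        (fun a => by simp only [diagGram]; grind) Y Z hZY' hu
      exact ⟨c, u, fun i => by rw [← hYξ, hcu _ (hxU i)]⟩
  have hvan : ∀ f ∈ Set.range lin ∪ Set.range quad ∪ Set.range cub, aeval x f = 0 := by
    rintro f ((⟨t, rfl⟩ | ⟨t, rfl⟩) | ⟨t, rfl⟩)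
    exacts [hlin0 t, hquad0 t, hcub0 t]
  refine ⟨a, b, c, _, lin, quad, cub, ha, hr, ?_, hc, hlin, hquad, hcub, hvan,
    fun ξ hξ h => ?_, fun f hf i => ?_⟩
  · simpa only [Nat.add_succ_sub_one] using hb
  · obtain ⟨Y, hYξ⟩ := hY ℂ ξ fun t => h _ (Or.inl (Or.inl ⟨t, rfl⟩))
    obtain ⟨Z, hZY, h1, h2⟩ := charts ℂ ξ Y hYξ h
    refine exists_eq_aeval_of_eq_mul hxH ?_
    by_contra hcon
    refine hξ (funext fun i => ?_)
    rw [← hYξ]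
    refine map_mem_of_charts_mem (by omega) Y Z hZY ⊥ (Ideal.isRadical_bot)
      (fun i hi j hj hij ε hε => ?_) (fun r hr => ?_) _ (hxU i)
    · by_contra hne
      exact hcon (h1 i hi j hj hij ε hε (IsUnit.mk0 _ hne))
    · by_contra hne
      exact hcon (h2 r hr (IsUnit.mk0 _ hne))
  · set J := Ideal.span (Set.range lin ∪ Set.range quad ∪ Set.range cub) with hJ
    let ξ : Fin (n + 1) → CoordRing n ⧸ J := fun i => Ideal.Quotient.mk J (X i)
    have hξ : ∀ g, aeval ξ g = Ideal.Quotient.mk J g := by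
      intro g
      have : aeval ξ = Ideal.Quotient.mkₐ ℂ J := by ext; simp [ξ]
      rw [this]; rfl
    have hξ0 : ∀ g ∈ Set.range lin ∪ Set.range quad ∪ Set.range cub, aeval ξ g = 0 :=
      fun g hg => by rw [hξ]; exact Ideal.Quotient.eq_zero_iff_mem.mpr (Ideal.subset_span hg)
    obtain ⟨Y, hYξ⟩ := hY _ ξ fun t => hξ0 _ (Or.inl (Or.inl ⟨t, rfl⟩))
    obtain ⟨Z, hZY, -, -⟩ := charts _ ξ Y hYξ hξ0
    -- A chart `g` is treated in the localization at `g`, where `Y` is followed by the localization.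
    have local_charts : ∀ g : CoordRing n ⧸ J, ∃ Y' : MvPolynomial (Fin m) ℂ →ₗ[ℂ]
        Localization.Away g, (∀ p, Y' p = algebraMap _ (Localization.Away g) (Y p)) ∧
        ∀ f ∈ Set.range lin ∪ Set.range quad ∪ Set.range cub,
          aeval (fun t => algebraMap _ (Localization.Away g) (ξ t)) f = 0 := by
      intro g
      refine ⟨(IsScalarTower.toAlgHom ℂ _ (Localization.Away g)).toLinearMap ∘ₗ Y, fun _ => rfl,
        fun f hf => ?_⟩
      have := aeval_algebraMap_apply (Localization.Away g) ξ f
      rw [hξ0 f hf, map_zero] at this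
      exact this
    have hmem : ξ i ∈ (Submodule.annihilator (Ideal.span {aeval ξ f})).radical := by
      rw [← hYξ]
      refine map_mem_of_charts_mem (by omega) Y Z hZY _ (Ideal.radical_isRadical _)
        (fun i hi j hj hij ε hε => ?_) (fun r hr => ?_) _ (hxU i)
      · obtain ⟨Y', hY', h0⟩ := local_charts (Y (isoForm i j ε * isoForm i j ε))
        obtain ⟨-, -, h1, -⟩ := charts _ _ Y' (fun t => by rw [hY', hYξ]) h0
        exact mem_radical_annihilator_of_chart hxH hf ξ _ (h1 i hi j hj hij ε hε (by
          rw [hY']; exact IsLocalization.Away.algebraMap_isUnit _))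
      · obtain ⟨Y', hY', h0⟩ := local_charts (Y (X r * X r))
        obtain ⟨-, -, -, h2⟩ := charts _ _ Y' (fun t => by rw [hY', hYξ]) h0
        exact mem_radical_annihilator_of_chart hxH hf ξ _ (h2 r hr (by
          rw [hY']; exact IsLocalization.Away.algebraMap_isUnit _))
    obtain ⟨N, hN⟩ := hmem
    refine ⟨N, ?_⟩
    rw [Submodule.mem_annihilator_span_singleton, hξ, smul_eq_mul, ← map_pow, ← map_mul] at hN
    exact Ideal.Quotient.eq_zero_iff_mem.mp hN

end Forms

/-! ### Coordinates on the configuration -/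

section Coordinates

variable {n m : ℕ} {W : Type*} [AddCommGroup W] [Module ℂ W]

/-- The elements of `W*` as linear polynomials in the coordinates on `W` given by a basis of
`W*`. -/
noncomputable def linForm (b : Module.Basis (Fin m) ℂ (Module.Dual ℂ W)) :
    Module.Dual ℂ W →ₗ[ℂ] MvPolynomial (Fin m) ℂ :=
  b.constr ℂ X

theorem linForm_basis (b : Module.Basis (Fin m) ℂ (Module.Dual ℂ W)) (a : Fin m) :
    linForm b (b a) = X a :=
  b.constr_basis ℂ _ a

theorem aeval_linForm (b : Module.Basis (Fin m) ℂ (Module.Dual ℂ W)) (w : W)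
    (v : Module.Dual ℂ W) : aeval (fun j => b j w) (linForm b v) = v w := by
  have : (aeval fun j => b j w).toLinearMap ∘ₗ linForm b = Module.Dual.eval ℂ W w :=
    b.ext fun a => by simp [linForm_basis]
  exact LinearMap.congr_fun this v

theorem exists_basis_apply_eq [FiniteDimensional ℂ W]
    (b : Module.Basis (Fin m) ℂ (Module.Dual ℂ W)) (u : Fin m → ℂ) : ∃ w : W, ∀ j, b j w = u j := by
  refine ⟨(Module.evalEquiv ℂ W).symm (b.constr ℂ u), fun j => ?_⟩
  rw [Module.apply_evalEquiv_symm_apply, b.constr_basis]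

/-- The square of the `i`-th coordinate of `ι`, as a polynomial. -/
noncomputable def squareForm (b : Module.Basis (Fin m) ℂ (Module.Dual ℂ W))
    (ι : W →ₗ[ℂ] (Fin (n + 1) → ℂ)) (i : Fin (n + 1)) : MvPolynomial (Fin m) ℂ :=
  linForm b (coordForm ι i) * linForm b (coordForm ι i)

theorem aeval_squareForm (b : Module.Basis (Fin m) ℂ (Module.Dual ℂ W))
    (ι : W →ₗ[ℂ] (Fin (n + 1) → ℂ)) (w : W) (i : Fin (n + 1)) :
    aeval (fun j => b j w) (squareForm b ι i) = ι w i ^ 2 := by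
  rw [squareForm, map_mul, aeval_linForm, pow_two]
  rfl

theorem linForm_mul_mem (b : Module.Basis (Fin m) ℂ (Module.Dual ℂ W)) (v v' : Module.Dual ℂ W) :
    linForm b v * linForm b v' ∈ homogeneousSubmodule (Fin m) ℂ 2 := by
  have h : ∀ v, (linForm b v).IsHomogeneous 1 := by
    have hle : Submodule.span ℂ (Set.range b) ≤
        (homogeneousSubmodule (Fin m) ℂ 1).comap (linForm b) := by
      rw [Submodule.span_le]
      rintro _ ⟨a, rfl⟩
      rw [SetLike.mem_coe, Submodule.mem_comap, linForm_basis]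
      exact isHomogeneous_X ℂ a
    exact fun v => hle (b.span_eq ▸ Submodule.mem_top)
  exact (h v).mul (h v')

theorem eval_coordForm_eq_zero {ι : W →ₗ[ℂ] (Fin (n + 1) → ℂ)}
    {Q : QuadraticForm ℂ (Module.Dual ℂ W)} (hQ : Q ∈ quadricsThrough (pointConfig ι))
    (i : Fin (n + 1)) : Q (coordForm ι i) = 0 := by
  by_cases h : coordForm ι i = 0
  · rw [h, QuadraticMap.map_zero]
  · exact hQ _ ⟨i, h, rfl⟩ _ (by
      rw [Projectivization.submodule_mk]; exact Submodule.mem_span_singleton_self _)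

/-- The squares `ℓᵢ²` span the polynomials apolar to the unique quadric through the configuration:
a functional that vanishes on the `ℓᵢ²` is a quadric through the configuration. -/
theorem span_squareForm {ι : W →ₗ[ℂ] (Fin (n + 1) → ℂ)} {Q : QuadraticForm ℂ (Module.Dual ℂ W)}
    (hQ : quadricsThrough (pointConfig ι) = Submodule.span ℂ {Q})
    (b : Module.Basis (Fin m) ℂ (Module.Dual ℂ W)) {G : Fin m → Fin m → ℂ}
    (hG : ∀ a a', QuadraticMap.associated Q (b a) (b a') = G a a') :
    Submodule.span ℂ (Set.range (squareForm b ι)) = apolar G := by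
  have hGs : ∀ a a', G a a' = G a' a := fun a a' => by
    rw [← hG, ← hG]
    exact QuadraticMap.associated_isSymm ℂ Q (b a) (b a')
  have hQm : Q ∈ quadricsThrough (pointConfig ι) := hQ ▸ Submodule.mem_span_singleton_self Q
  -- the bilinear form `(v, v') ↦ φ (v v')` of a functional `φ`
  let β : (MvPolynomial (Fin m) ℂ →ₗ[ℂ] ℂ) → LinearMap.BilinForm ℂ (Module.Dual ℂ W) := fun φ =>
    ((LinearMap.mul ℂ (MvPolynomial (Fin m) ℂ)).compl₁₂ (linForm b) (linForm b)).compr₂ φ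
  have hβ : ∀ φ v v', β φ v v' = φ (linForm b v * linForm b v') := fun φ v v' => rfl
  refine le_antisymm ?_ fun p hp => ?_
  · rw [Submodule.span_le]
    rintro _ ⟨i, rfl⟩
    refine ⟨linForm_mul_mem b _ _, ?_⟩
    have h : β (contraction G) = QuadraticMap.associated Q := by
      refine LinearMap.ext_basis b b fun a a' => ?_
      rw [hβ, linForm_basis, linForm_basis, contraction_X_mul_X hGs, hG]
    have h1 := hβ (contraction G) (coordForm ι i) (coordForm ι i)
    rw [h, QuadraticMap.associated_eq_self_apply, eval_coordForm_eq_zero hQm] at h1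
    exact h1.symm
  · rw [← Subspace.forall_mem_dualAnnihilator_apply_eq_zero_iff]
    intro φ hφ
    have hφ0 : ∀ i, φ (squareForm b ι i) = 0 := fun i =>
      (Submodule.mem_dualAnnihilator φ).mp hφ _ (Submodule.subset_span ⟨i, rfl⟩)
    have hmem : (β φ).toQuadraticMap ∈ quadricsThrough (pointConfig ι) := by
      rintro _ ⟨i, hi, rfl⟩ v hv
      rw [Projectivization.submodule_mk] at hv
      obtain ⟨c, rfl⟩ := Submodule.mem_span_singleton.mp hv
      have h1 : β φ (coordForm ι i) (coordForm ι i) = 0 := hφ0 i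
      rw [QuadraticMap.map_smul, LinearMap.BilinMap.toQuadraticMap_apply, h1, smul_zero]
    rw [hQ] at hmem
    obtain ⟨c, hc⟩ := Submodule.mem_span_singleton.mp hmem
    have hφG : ∀ a a', φ (X a * X a') = c * G a a' := by
      intro a a'
      have h1 := congrArg (fun q => QuadraticMap.associated q (b a) (b a')) hc
      simp only [map_smul, LinearMap.smul_apply, hG, smul_eq_mul] at h1
      rw [h1, QuadraticMap.associated_toQuadraticMap, hβ, hβ, linForm_basis, linForm_basis,
        mul_comm (X a') (X a)]
      simp only [← two_mul, Module.End.smul_def]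
      simp
    have hle : homogeneousSubmodule (Fin m) ℂ 2 ≤ LinearMap.eqLocus φ (c • contraction G) := by
      refine homogeneousSubmodule_le_of_prod_X_mem _ fun a => ?_
      rw [LinearMap.mem_eqLocus, Fin.prod_univ_two, hφG, LinearMap.smul_apply,
        contraction_X_mul_X hGs, smul_eq_mul]
    have h1 : φ p = c * contraction G p := hle hp.1
    have h2 : contraction G p = 0 := hp.2
    rw [h1, h2, mul_zero]

end Coordinates

/-! ### Normal forms of the quadric -/

section NormalForm

variable {m : ℕ} {V : Type*} [AddCommGroup V] [Module ℂ V]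

/-- Every complex quadratic form is a sum of squares in a suitable basis. -/
theorem exists_basis_associated_eq_diagGram [FiniteDimensional ℂ V]
    (hV : Module.finrank ℂ V = m) (Q : QuadraticForm ℂ V) :
    ∃ (b : Module.Basis (Fin m) ℂ V) (P : Finset (Fin m)),
      ∀ a a', QuadraticMap.associated Q (b a) (b a') = diagGram P a a' := by
  classical
  subst hV
  obtain ⟨v, hv⟩ := LinearMap.BilinForm.exists_orthogonal_basis
    (QuadraticForm.associated_isSymm ℂ Q)
  set β := QuadraticMap.associated Q with hβ
  -- factors that rescale the non-isotropic basis vectors to length one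
  have hz : ∀ a, ∃ z : ℂˣ, β (v a) (v a) ≠ 0 → (z : ℂ) * z * β (v a) (v a) = 1 := by
    intro a
    by_cases h : β (v a) (v a) = 0
    · exact ⟨1, fun h' => absurd h h'⟩
    · obtain ⟨z, hz⟩ := IsAlgClosed.exists_eq_mul_self (β (v a) (v a))⁻¹
      have hz0 : z ≠ 0 := by rintro rfl; simp_all
      exact ⟨Units.mk0 z hz0, fun _ => by simp [← hz, h]⟩
  choose z hz using hz
  refine ⟨v.unitsSMul z, Finset.univ.filter fun a => β (v a) (v a) ≠ 0, fun a a' => ?_⟩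
  simp only [Module.Basis.unitsSMul_apply, Units.smul_def, map_smul, LinearMap.smul_apply,
    smul_eq_mul]
  by_cases haa : a = a'
  · subst haa
    by_cases h : β (v a) (v a) = 0
    · simp [diagGram, h]
    · simp only [diagGram, Finset.mem_filter, Finset.mem_univ, ne_eq, h,
        not_false_eq_true, and_self, if_true]
      rw [← hz a h]; ring
  · have : β (v a) (v a') = 0 := hv haa
    rw [diagGram_of_ne _ haa, this]; simp

theorem associated_basis_eq_coord {Q : QuadraticForm ℂ V} {b : Module.Basis (Fin m) ℂ V}
    {P : Finset (Fin m)}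
    (h : ∀ a a', QuadraticMap.associated Q (b a) (b a') = diagGram P a a') (a : Fin m) :
    QuadraticMap.associated Q (b a) = if a ∈ P then b.coord a else 0 := by
  refine b.ext fun a' => ?_
  rw [h]
  split_ifs with ha
  · simp [diagGram, ha, Finsupp.single_apply, eq_comm]
  · simp [diagGram, ha]

theorem quadRank_eq_card {Q : QuadraticForm ℂ V} {b : Module.Basis (Fin m) ℂ V}
    {P : Finset (Fin m)}
    (h : ∀ a a', QuadraticMap.associated Q (b a) (b a') = diagGram P a a') :
    quadRank Q = P.card := by
  have hrange : LinearMap.range (QuadraticMap.associated Q) =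
      Submodule.span ℂ (Set.range fun a : P => b.coord a) := by
    rw [← Submodule.map_top, ← b.span_eq, Submodule.map_span, ← Set.range_comp]
    refine le_antisymm (Submodule.span_le.mpr ?_) (Submodule.span_le.mpr ?_)
    · rintro _ ⟨a, rfl⟩
      rw [Function.comp_apply, associated_basis_eq_coord h]
      split_ifs with ha
      · exact Submodule.subset_span ⟨⟨a, ha⟩, rfl⟩
      · exact Submodule.zero_mem _
    · rintro _ ⟨a, rfl⟩
      refine Submodule.subset_span ⟨a, ?_⟩
      rw [Function.comp_apply, associated_basis_eq_coord h, if_pos a.2]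
  have hli : LinearIndependent ℂ fun a : P => b.coord a := by
    have h1 : LinearIndependent ℂ fun a => b.coord a := by
      simp
    exact h1.comp _ Subtype.val_injective
  rw [quadRank, hrange, finrank_span_eq_card hli, Fintype.card_coe]

/-- A complex quadratic form of rank two is hyperbolic in a suitable basis. -/
theorem exists_basis_associated_eq_hypGram {Q : QuadraticForm ℂ V} {b : Module.Basis (Fin m) ℂ V}
    {P : Finset (Fin m)}
    (h : ∀ a a', QuadraticMap.associated Q (b a) (b a') = diagGram P a a') (hP : P.card = 2) :
    ∃ (b' : Module.Basis (Fin m) ℂ V) (i j : Fin m), i ≠ j ∧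
      ∀ a a', QuadraticMap.associated Q (b' a) (b' a') = hypGram i j a a' := by
  classical
  obtain ⟨i, j, hij, rfl⟩ := Finset.card_eq_two.mp hP
  let v : Fin m → V := fun a => if a = i then b i + Complex.I • b j else
    if a = j then (1 / 2 : ℂ) • (b i - Complex.I • b j) else b a
  have hvi : v i = b i + Complex.I • b j := by simp [v]
  have hvj : v j = (1 / 2 : ℂ) • (b i - Complex.I • b j) := by simp [v, hij.symm]
  have hva : ∀ a, a ≠ i → a ≠ j → v a = b a := fun a hi hj => by simp [v, hi, hj]
  have hspan : ⊤ ≤ Submodule.span ℂ (Set.range v) := by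
    rw [← b.span_eq, Submodule.span_le]
    have hv : ∀ a, v a ∈ Submodule.span ℂ (Set.range v) := fun a =>
      Submodule.subset_span ⟨a, rfl⟩
    rintro _ ⟨a, rfl⟩
    by_cases hi : a = i
    · subst hi
      have : b a = (1 / 2 : ℂ) • v a + v j := by
        rw [hvi, hvj]; module
      rw [this]
      exact add_mem (Submodule.smul_mem _ _ (hv _)) (hv _)
    by_cases hj : a = j
    · subst hj
      have : b a = (-Complex.I) • ((1 / 2 : ℂ) • v i - v a) := by
        rw [hvi, hvj]
        match_scalars
        · linear_combination Complex.I_mul_I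
        · ring
      rw [this]
      exact Submodule.smul_mem _ _ (sub_mem (Submodule.smul_mem _ _ (hv _)) (hv _))
    rw [← hva a hi hj]
    exact hv a
  refine ⟨basisOfTopLeSpanOfCardEqFinrank v hspan (by
    rw [Module.finrank_eq_card_basis b]), i, j, hij, fun a a' => ?_⟩
  rw [coe_basisOfTopLeSpanOfCardEqFinrank]
  have hii : QuadraticMap.associated Q (b i) (b i) = 1 := by simp [h, diagGram]
  have hjj : QuadraticMap.associated Q (b j) (b j) = 1 := by simp [h, diagGram]
  have hne : ∀ {a a'}, a ≠ a' → QuadraticMap.associated Q (b a) (b a') = 0 := fun haa => by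
    rw [h, diagGram_of_ne _ haa]
  have hother : ∀ a a', a ≠ i → a ≠ j → QuadraticMap.associated Q (b a) (b a') = 0 := by
    intro a a' hai haj
    rw [h]; simp [diagGram, hai, haj]
  by_cases hai : a = i
  · subst hai
    by_cases hai' : a' = a
    · subst hai'
      rw [hypGram_eq_zero (by grind), hvi]
      simp only [map_add, map_smul, LinearMap.add_apply, LinearMap.smul_apply, hii, hjj, hne hij,
        hne hij.symm, smul_eq_mul]
      linear_combination Complex.I_mul_I
    by_cases haj' : a' = j
    · subst haj'
      rw [hypGram_self, hvi, hvj]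
      simp only [map_add, map_sub, map_smul, LinearMap.add_apply, LinearMap.smul_apply, hii, hjj,
        hne hij, hne hij.symm, smul_eq_mul]
      linear_combination (-1 / 2) * Complex.I_mul_I
    · rw [hypGram_eq_zero (by grind), hvi, hva a' hai' haj']
      simp only [map_add, map_smul, LinearMap.add_apply, LinearMap.smul_apply,
        hne (Ne.symm hai'), hne (Ne.symm haj'), smul_zero, add_zero]
  by_cases haj : a = j
  · subst haj
    by_cases hai' : a' = i
    · subst hai'
      rw [hypGram_comm, hypGram_self, hvi, hvj]
      simp only [map_add, map_sub, map_smul, LinearMap.sub_apply, LinearMap.smul_apply, hii, hjj,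
        hne hij, hne hij.symm, smul_eq_mul]
      linear_combination (-1 / 2) * Complex.I_mul_I
    by_cases haj' : a' = a
    · subst haj'
      rw [hypGram_eq_zero (by grind), hvj]
      simp only [map_sub, map_smul, LinearMap.sub_apply, LinearMap.smul_apply, hii, hjj,
        hne hij, hne hij.symm, smul_eq_mul]
      linear_combination (1 / 4) * Complex.I_mul_I
    · rw [hypGram_eq_zero (by grind), hvj, hva a' hai' haj']
      simp only [map_sub, map_smul, LinearMap.sub_apply, LinearMap.smul_apply,
        hne (Ne.symm hai'), hne (Ne.symm haj'), smul_zero, sub_zero]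
  rw [hypGram_eq_zero (by grind), hva a hai haj]
  by_cases hai' : a' = i
  · subst hai'
    simp [hvi, hother a _ hai haj]
  by_cases haj' : a' = j
  · subst haj'
    simp [hvj, hother a _ hai haj]
  rw [hva a' hai' haj', hother a a' hai haj]

end NormalForm

/-! ### The square of a linear space -/

section Geometry

variable {n : ℕ} {W : Type*} [AddCommGroup W] [Module ℂ W]

theorem mk_mem_coordSq_image_iff (ι : W →ₗ[ℂ] (Fin (n + 1) → ℂ)) (hι : Function.Injective ι)
    (v : Fin (n + 1) → ℂ) (hv : v ≠ 0) :
    Projectivization.mk ℂ v hv ∈ coordSq '' linearSpace ι hι ↔ ∃ w, ∀ i, v i = ι w i ^ 2 := by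
  constructor
  · rintro ⟨_, ⟨q, rfl⟩, hq⟩
    induction q using Projectivization.ind with | h w hw =>
    rw [Projectivization.map_mk, coordSq_mk, Projectivization.mk_eq_mk_iff'] at hq
    obtain ⟨c, hc⟩ := hq
    obtain ⟨d, hd⟩ := IsAlgClosed.exists_eq_mul_self c
    have hc0 : c ≠ 0 := by
      rintro rfl
      refine sq_coords_ne_zero (v := ι w) (fun h => hw (hι (by rw [h, map_zero]))) ?_
      rw [← hc, zero_smul]
    have hd0 : d ≠ 0 := by rintro rfl; simp_all
    refine ⟨d⁻¹ • w, fun i => ?_⟩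
    have h1 : c * v i = ι w i ^ 2 := congrFun hc i
    rw [map_smul, Pi.smul_apply, smul_eq_mul, mul_pow, ← h1, hd]
    field_simp
  · rintro ⟨w, hw⟩
    have hw0 : w ≠ 0 := by
      rintro rfl
      exact hv (funext fun i => by simp [hw])
    refine ⟨_, ⟨Projectivization.mk ℂ w hw0, rfl⟩, ?_⟩
    rw [Projectivization.map_mk, coordSq_mk]
    congr 1
    exact (funext hw).symm

theorem mem_affineCone_iff [Nontrivial W] (ι : W →ₗ[ℂ] (Fin (n + 1) → ℂ))
    (hι : Function.Injective ι) (v : Fin (n + 1) → ℂ) :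
    v ∈ affineCone (coordSq '' linearSpace ι hι) ↔ ∃ w, ∀ i, v i = ι w i ^ 2 := by
  by_cases hv : v = 0
  · subst hv
    obtain ⟨w, hw⟩ := exists_ne (0 : W)
    exact ⟨fun _ => ⟨0, by simp⟩, fun _ =>
      ⟨_, ⟨_, ⟨Projectivization.mk ℂ w hw, rfl⟩, rfl⟩, Submodule.zero_mem _⟩⟩
  · rw [← mk_mem_coordSq_image_iff ι hι v hv]
    constructor
    · rintro ⟨p, hp, hvp⟩
      have : Projectivization.mk ℂ v hv = p := by
        induction p using Projectivization.ind with | h u hu =>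
        rw [Projectivization.submodule_mk] at hvp
        obtain ⟨c, hc⟩ := Submodule.mem_span_singleton.mp hvp
        exact (Projectivization.mk_eq_mk_iff' ℂ v u hv hu).mpr ⟨c, hc⟩
      rwa [this]
    · intro h
      exact ⟨_, h, by
        rw [Projectivization.submodule_mk]; exact Submodule.mem_span_singleton_self _⟩

theorem mem_definingIdeal_iff [Nontrivial W] (ι : W →ₗ[ℂ] (Fin (n + 1) → ℂ))
    (hι : Function.Injective ι) (f : CoordRing n) :
    f ∈ definingIdeal (coordSq '' linearSpace ι hι) ↔
      ∀ w, aeval (fun i => ι w i ^ 2) f = 0 := by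
  simp only [definingIdeal, mem_vanishingIdeal_iff, mem_affineCone_iff]
  exact ⟨fun h w => h _ ⟨w, fun _ => rfl⟩, fun h v ⟨w, hw⟩ => by
    rw [show v = fun i => ι w i ^ 2 from funext hw]; exact h w⟩

/-- A set of forms in the vanishing ideal cuts out the square of a linear space as soon as its
non-zero common zeros are squares of vectors of the linear space. -/
theorem coordSq_image_eq_projZeros [Nontrivial W] (ι : W →ₗ[ℂ] (Fin (n + 1) → ℂ))
    (hι : Function.Injective ι) (S : Set (CoordRing n))
    (h1 : ∀ f ∈ S, f ∈ definingIdeal (coordSq '' linearSpace ι hι))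
    (h2 : ∀ v : Fin (n + 1) → ℂ, v ≠ 0 → (∀ f ∈ S, aeval v f = 0) → ∃ w, ∀ i, v i = ι w i ^ 2) :
    coordSq '' linearSpace ι hι = projZeros (Ideal.span S) := by
  ext p
  constructor
  · intro hp f hf v hv
    exact Ideal.span_le.mpr h1 hf v ⟨p, hp, hv⟩
  · intro hp
    induction p using Projectivization.ind with | h v hv =>
    rw [mk_mem_coordSq_image_iff]
    exact h2 v hv fun f hf => hp f (Ideal.subset_span hf) v (by
      rw [Projectivization.submodule_mk]; exact Submodule.mem_span_singleton_self _)

/-- Two nested ideals define the same subscheme if the larger one is moved into the smaller one by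
powers of each coordinate. -/
theorem sameSubscheme_of_pow_mul_mem {I J : Ideal (CoordRing n)} (hIJ : I ≤ J)
    (h : ∀ f ∈ J, ∀ i, ∃ N : ℕ, X i ^ N * f ∈ I) : SameSubscheme I J := by
  intro i
  refine le_antisymm (Ideal.map_mono hIJ) (Ideal.map_le_iff_le_comap.mpr fun f hf => ?_)
  obtain ⟨N, hN⟩ := h f hf i
  have := Ideal.mem_map_of_mem (chart i) hN
  rw [map_mul, map_pow] at this
  simpa [chart] using this

end Geometry

section Rank

variable {n m : ℕ} {W : Type*} [AddCommGroup W] [Module ℂ W]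

/-- The quadric through the configuration has rank at least two: if it were the square of a vector
of `W`, all `ℓᵢ` would vanish at this vector. -/
theorem two_le_card [FiniteDimensional ℂ W] {ι : W →ₗ[ℂ] (Fin (n + 1) → ℂ)}
    (hι : Function.Injective ι) {Q : QuadraticForm ℂ (Module.Dual ℂ W)} (hQ0 : Q ≠ 0)
    (hQ : Q ∈ quadricsThrough (pointConfig ι)) {b : Module.Basis (Fin m) ℂ (Module.Dual ℂ W)}
    {P : Finset (Fin m)}
    (h : ∀ a a', QuadraticMap.associated Q (b a) (b a') = diagGram P a a') : 2 ≤ P.card := by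
  by_contra! hP
  rcases Nat.lt_succ_iff_lt_or_eq.mp hP with h0 | h1
  · have hP0 : P = ∅ := Finset.card_eq_zero.mp (by omega)
    have h1 : QuadraticMap.associated Q = 0 := b.ext fun j => by
      rw [associated_basis_eq_coord h, hP0]; simp
    refine hQ0 (QuadraticMap.ext fun v => ?_)
    rw [← QuadraticMap.associated_eq_self_apply ℂ Q v, h1]
    rfl
  · obtain ⟨a, rfl⟩ := Finset.card_eq_one.mp h1
    obtain ⟨w, hw⟩ := exists_basis_apply_eq b (Pi.single a 1)
    have hv : ∀ v, v w = b.coord a v := fun v => by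
      have : Module.Dual.eval ℂ W w = b.coord a := b.ext fun j => by
        simp [hw, Finsupp.single_apply, Pi.single_apply, eq_comm]
      exact LinearMap.congr_fun this v
    have hQv : ∀ v, Q v = b.coord a v * b.coord a v := fun v => by
      have : QuadraticMap.associated Q = (b.coord a).smulRight (b.coord a) := b.ext fun j => by
        rw [associated_basis_eq_coord h]
        by_cases hj : j = a
        · simp [hj]
        · simp [hj]
      rw [← QuadraticMap.associated_eq_self_apply ℂ Q v, this]
      rfl
    have hw0 : w = 0 := hι (funext fun i => by
      have h2 := eval_coordForm_eq_zero hQ i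
      rw [hQv, mul_self_eq_zero, ← hv] at h2
      rw [map_zero]
      exact h2)
    have := hw a
    simp [hw0] at this

end Rank

/-! ### Counting the forms -/

theorem choose_two_succ_rat (r N : ℕ) (h : r + 1 = N) :
    ((r + 1).choose 2 : ℚ) = N * (N - 1) / 2 := by
  rw [h, Nat.cast_choose_two]

theorem choose_four_rat (k : ℕ) :
    ((k + 1 + 3).choose 4 : ℚ) = (k + 4) * (k + 3) * (k + 2) * (k + 1) / 24 := by
  have h := Nat.descFactorial_eq_factorial_mul_choose (k + 1 + 3) 4
  have h' : (((k + 1 + 3).descFactorial 4 : ℕ) : ℚ) = 24 * ((k + 1 + 3).choose 4 : ℚ) := by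
    rw [h]; push_cast; norm_num [Nat.factorial]
  have h2 : (k + 1 + 3).descFactorial 4 = (k + 4) * (k + 3) * (k + 2) * (k + 1) := by
    simp only [Nat.descFactorial]
    simp
    ring
  rw [h2] at h'
  push_cast at h'
  linarith

/-- The number of quadratic relations, in closed form. -/
theorem card_quadratic_relations (k r b e : ℕ) (hr : r + 1 = (k + 1 + 1).choose 2)
    (hb : b + (k + 1 + 3).choose 4 = (r + 1).choose 2 + e) :
    (b : ℚ) = ((k : ℚ) + 3) * (k + 2) * (k + 1) * (k - 2) / 12 + e := by
  have h1 : (b : ℚ) + ((k + 1 + 3).choose 4 : ℚ) = ((r + 1).choose 2 : ℚ) + e := by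
    exact_mod_cast hb
  rw [choose_four_rat, choose_two_succ_rat r _ hr, Nat.cast_choose_two] at h1
  push_cast at h1
  linear_combination h1

/-! ### Equations of the square -/

theorem mainTheorem7 {n k s : ℕ} {W : Type*} [AddCommGroup W] [Module ℂ W]
    (hk : Module.finrank ℂ W = k + 1)
    (ι : W →ₗ[ℂ] (Fin (n + 1) → ℂ)) (hι : Function.Injective ι)
    (Q : QuadraticForm ℂ (Module.Dual ℂ W)) (hQ0 : Q ≠ 0)
    (hQ : quadricsThrough (pointConfig ι) = Submodule.span ℂ {Q})
    (hs : quadRank Q = s) :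
    2 ≤ s ∧
    ∃ (a b c : ℕ) (lin : Fin a → CoordRing n) (quad : Fin b → CoordRing n)
      (cub : Fin c → CoordRing n),
      (a : ℤ) = (n : ℤ) - ((k + 2).choose 2 : ℤ) + 2 ∧
      (b : ℚ) = ((k : ℚ) + 3) * (k + 2) * (k + 1) * (k - 2) / 12 + (if s = 2 then 2 else 0) ∧
      c = (if s = 3 then 7 else 0) ∧
      IsFormSystem 1 lin ∧ IsFormSystem 2 quad ∧ IsFormSystem 3 cub ∧
      coordSq '' linearSpace ι hι =
        projZeros (Ideal.span (Set.range lin ∪ Set.range quad ∪ Set.range cub)) ∧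
      (3 ≤ s →
        SameSubscheme (Ideal.span (Set.range lin ∪ Set.range quad ∪ Set.range cub))
          (definingIdeal (coordSq '' linearSpace ι hι))) := by
  have hfin : FiniteDimensional ℂ W := Module.finite_of_finrank_pos (by omega)
  have hnt : Nontrivial W := Module.nontrivial_of_finrank_pos (R := ℂ) (by omega)
  have hQm : Q ∈ quadricsThrough (pointConfig ι) := hQ ▸ Submodule.mem_span_singleton_self Q
  obtain ⟨b, P, hb⟩ := exists_basis_associated_eq_diagGram
    (Subspace.dual_finrank_eq.trans hk : Module.finrank ℂ (Module.Dual ℂ W) = k + 1) Q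
  obtain rfl : P.card = s := (quadRank_eq_card hb).symm.trans hs
  have h2 := two_le_card hι hQ0 hQm hb
  -- Polynomials that vanish on the `ℓᵢ²` are those in the vanishing ideal.
  have hideal : ∀ (b : Module.Basis (Fin (k + 1)) ℂ (Module.Dual ℂ W)) (f : CoordRing n),
      f ∈ definingIdeal (coordSq '' linearSpace ι hι) ↔ aeval (squareForm b ι) f = 0 := by
    intro b f
    have h : ∀ u : Fin (k + 1) → ℂ, aeval u (aeval (squareForm b ι) f) =
        aeval (fun i => aeval u (squareForm b ι i)) f := by
      intro u
      have : (aeval u).comp (aeval (squareForm b ι)) =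
          aeval (R := ℂ) (fun i => aeval u (squareForm b ι i)) := by
        ext i; simp
      exact DFunLike.congr_fun this f
    rw [mem_definingIdeal_iff]
    constructor
    · intro hf
      refine MvPolynomial.funext fun u => ?_
      obtain ⟨w, hw⟩ := exists_basis_apply_eq b u
      obtain rfl : (fun j => b j w) = u := funext hw
      rw [map_zero, ← coe_aeval_eq_eval, RingHom.coe_coe, h]
      simp only [aeval_squareForm]
      exact hf w
    · intro hf w
      have := h fun j => b j w
      simp only [aeval_squareForm, hf, map_zero] at this
      exact this.symm
  have hpoint : ∀ (b : Module.Basis (Fin (k + 1)) ℂ (Module.Dual ℂ W)) (v : Fin (n + 1) → ℂ),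
      (∃ u : Fin (k + 1) → ℂ, ∀ i, v i = aeval u (squareForm b ι i)) →
        ∃ w, ∀ i, v i = ι w i ^ 2 := by
    rintro b v ⟨u, hu⟩
    obtain ⟨w, hw⟩ := exists_basis_apply_eq b u
    obtain rfl : (fun j => b j w) = u := funext hw
    exact ⟨w, fun i => by rw [hu, aeval_squareForm]⟩
  refine ⟨h2, ?_⟩
  rcases h2.lt_or_eq with h3 | h2
  · obtain ⟨a, d, c, r, lin, quad, cub, ha, hr, hd, hc, hlin, hquad, hcub, hvan, hset, hsch⟩ :=
      exists_forms_of_diag h3 (span_squareForm hQ b hb)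
    have hvan' : ∀ f ∈ Set.range lin ∪ Set.range quad ∪ Set.range cub,
        f ∈ definingIdeal (coordSq '' linearSpace ι hι) := fun f hf =>
      (hideal b f).mpr (hvan f hf)
    refine ⟨a, d, c, lin, quad, cub, ?_, ?_, hc, hlin, hquad, hcub,
      coordSq_image_eq_projZeros ι hι _ hvan' fun v hv h => hpoint b v (hset v hv h),
      fun _ => sameSubscheme_of_pow_mul_mem (Ideal.span_le.mpr hvan') fun f hf i =>
        hsch f ((hideal b f).mp hf) i⟩
    · have hr' : r + 1 = (k + 2).choose 2 := hr
      omega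
    · rw [if_neg (by omega)]
      exact_mod_cast card_quadratic_relations k r d 0 hr hd
  · obtain ⟨b', i, j, hij, hb'⟩ := exists_basis_associated_eq_hypGram hb h2.symm
    obtain ⟨a, d, r, lin, quad, ha, hr, hd, hlin, hquad, hvan, hset⟩ :=
      exists_forms_of_hyp hij (span_squareForm hQ b' hb')
    refine ⟨a, d, 0, lin, quad, Fin.elim0, ?_, ?_, ?_, hlin, hquad,
      ⟨fun t => t.elim0, linearIndependent_empty_type⟩, ?_, fun h => by omega⟩
    · have hr' : r + 1 = (k + 2).choose 2 := hr
      omega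
    · rw [if_pos h2.symm]
      exact_mod_cast card_quadratic_relations k r d 2 hr hd
    · rw [if_neg (by omega)]
    · rw [Set.range_eq_empty (Fin.elim0 : Fin 0 → CoordRing n), Set.union_empty]
      exact coordSq_image_eq_projZeros ι hι _ (fun f hf => (hideal b' f).mpr (hvan f hf))
        fun v _ h => hpoint b' v (hset v h)
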